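/- For $1\le r\le n$ let $\mathcal V_{n,r}$ be the $r$-dimensional volume of the simplex whose vertices are $r+1$ independent standard Gaussian random points in $\mathbb R^n$, and put $\mathcal L_{n,r}=\log(r!\,\mathcal V_{n,r})$. Let $$m_n=\tfrac12\Big(n\log n-n+\tfrac12\log n+\log(2^{3/2}\pi)\Big).$$ Let $r=r(n)$, $n=1,2,\dots$, be integers with $1\le r(n)\le n$ and $n-r\to\infty$ as $n\to\infty$, and put $$X_n=\mathcal L_{n,r}-(m_n-m_{n-r})-\tfrac12\log\Big(\frac{(r+1)(n-r)}{n}\Big)$$ (with any finite convention for the centring in the finitely many cases $r=n$). Then $\mathbb E\,e^{tX_n}$ exists for all complex $t$ with $\operatorname{Re}t>-(n-r+1)$, and $$\lim_{n\to\infty}\frac{\mathbb E\,e^{tX_n}}{e^{\frac14t^2\log\frac n{n-r}}}=1$$ locally uniformly in $t\in\mathbb C$. If, additionally, $n-r=o(n)$, then $(X_n)_{n\ge1}$ converges in the mod-Gaussian sense on the strip $\{t\in\mathbb C:\operatorname{Re}t>-1\}$ with parameters $w_n=\frac12\log\frac n{n-r}$ and limit function identically equal to $1$; that is, $w_n\to\infty$,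 all the $\mathbb E\,e^{tX_n}$ exist on this strip, and $\mathbb E\,e^{tX_n}/e^{w_n\eta(t)}\to1$ locally uniformly on it, where $\eta(t)=\frac12t^2$ is the exponent in the moment generating function $e^{\eta(t)}$ of the standard normal law. -/

import Mathlib

open MeasureTheory ProbabilityTheory Filter Asymptotics

noncomputable section

namespace RandomSimplex

/-- The `r`-dimensional volume of the simplex with vertices `x 0, …, x r` in `ℝⁿ`. Here `μHE[r]` is
the `r`-dimensional Hausdorff measure normalised so as to agree with Lebesgue measure on
`r`-dimensional Euclidean subspaces. -/
def simplexVolume {n r : ℕ} (x : Fin (r + 1) → EuclideanSpace ℝ (Fin n)) : ℝ :=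
  (μHE[r] (convexHull ℝ (Set.range x))).toReal

/-- `log (r! V)`, where `V` is the `r`-volume of the simplex with vertices `x 0, …, x r`. -/
def logVolume {n r : ℕ} (x : Fin (r + 1) → EuclideanSpace ℝ (Fin n)) : ℝ :=
  Real.log ((Nat.factorial r : ℝ) * simplexVolume x)

/-- The Gaussian model: `r + 1` independent standard normal points in `ℝⁿ`. -/
structure IsGaussianSample {Ω : Type*} [MeasurableSpace Ω] (P : Measure Ω) {n r : ℕ}
    (X : Fin (r + 1) → Ω → EuclideanSpace ℝ (Fin n)) : Prop where
  hasLaw : ∀ i, HasLaw (X i) (stdGaussian (EuclideanSpace ℝ (Fin n))) P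
  indep : iIndepFun X P

/-- `m_n = (n log n - n + (log n) / 2 + log (2^{3/2} π)) / 2`. -/
def centering (n : ℕ) : ℝ :=
  (1 / 2) * (n * Real.log n - n + (1 / 2) * Real.log n
    + Real.log ((2 : ℝ) ^ (3 / 2 : ℝ) * Real.pi))

/-- The log-volume of the simplex with vertices `x 0, …, x r`, minus
`(m_n - m_{n-r}) + (1/2) log ((r+1)(n-r)/n)`. Meant for `1 ≤ r ≤ n`. -/
def centredLogVolume {n r : ℕ} (x : Fin (r + 1) → EuclideanSpace ℝ (Fin n)) : ℝ :=
  logVolume x - (centering n - centering (n - r))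
    - (1 / 2) * Real.log (((r : ℝ) + 1) * ((n : ℝ) - r) / n)

/-- The vertical strip `{z | a < Re z < b}`, where `a` and `b` may be infinite. -/
def strip (a b : EReal) : Set ℂ := {z | a < (z.re : EReal) ∧ (z.re : EReal) < b}

/-- `φ` is a probability law that is, for every `k ≥ 1`, the law of a sum of `k` i.i.d. variables. -/
def IsInfinitelyDivisible (φ : Measure ℝ) : Prop :=
  IsProbabilityMeasure φ ∧ ∀ k : ℕ, 1 ≤ k → ∃ ν : Measure ℝ, IsProbabilityMeasure ν ∧
    (Measure.pi fun _ : Fin k => ν).map (fun x => ∑ i, x i) = φ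

/-- Mod-`φ` convergence, on the strip `strip a b`, of the sequence of random variables
`X 1, X 2, …`, where `X n` lives on the probability space `(Ω n, P n)`, with parameters `w n` and
limit function `ψ`; here `exp ∘ η` is the moment generating function of `φ` on the strip.
The index `n = 0` is disregarded. -/
structure ModPhiConverges {Ω : ℕ → Type*} [∀ n, MeasurableSpace (Ω n)] (P : ∀ n, Measure (Ω n))
    (X : ∀ n, Ω n → ℝ) (φ : Measure ℝ) (η : ℂ → ℂ) (w : ℕ → ℝ) (ψ : ℂ → ℂ) (a b : EReal) :
    Prop where
  lt : a < b
  infinitelyDivisible : IsInfinitelyDivisible φ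
  integrable_exp : ∀ z ∈ strip a b, Integrable (fun x : ℝ => Complex.exp (z * x)) φ
  mgf_eq : ∀ z ∈ strip a b, ∫ x : ℝ, Complex.exp (z * x) ∂φ = Complex.exp (η z)
  aemeasurable : ∀ n, 1 ≤ n → AEMeasurable (X n) (P n)
  integrable : ∀ n, 1 ≤ n → ∀ z ∈ strip a b,
    Integrable (fun ω => Complex.exp (z * X n ω)) (P n)
  tendsto_param : Tendsto w atTop atTop
  analytic : AnalyticOnNhd ℂ ψ (strip a b)
  tendsto : TendstoLocallyUniformlyOn
    (fun n z => complexMGF (X n) (P n) z / Complex.exp (w n * η z)) ψ atTop (strip a b)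

/-- Mod-Gaussian convergence: mod-`φ` convergence with `φ` standard normal, `η(z) = z² / 2`. -/
def ModGaussianConverges {Ω : ℕ → Type*} [∀ n, MeasurableSpace (Ω n)] (P : ∀ n, Measure (Ω n))
    (X : ∀ n, Ω n → ℝ) (w : ℕ → ℝ) (ψ : ℂ → ℂ) (a b : EReal) : Prop :=
  ModPhiConverges P X (gaussianReal 0 1) (fun z => z ^ 2 / 2) w ψ a b

end RandomSimplex

end

namespace RandomSimplex

/-! The squared volume is a Gram determinant of the edge vectors `x i - x 0`. An orthogonal change
of the sample whose first row is constant replaces these dependent edges by `r` independent standard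
Gaussian vectors, at the price of a factor `r + 1` (`det_gram_sub_eq`, `map_rotate_pi_stdGaussian`).
Adding a vector to a family multiplies its Gram determinant by the squared length of the component
orthogonal to the family. For a Gaussian vector that component is standard Gaussian in a space whose
dimension does not depend on the family, so `E (r! V)^t` is `(r+1)^(t/2)` times a product of chi
moments in dimensions `n-r+1, …, n` (`integral_exp_log_det_gram`, `logVolume_moment`). The smallest
dimension gives the half-plane of existence.

Each chi moment is a ratio of Gamma functions: in dimension `k+1` it equals `(k+1)^(t/2) exp((t²/4 -
t/2)/(k+1))` up to a factor `1 + O(k⁻²)`, uniformly for bounded `t`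
(`exists_norm_gammaRatio_sub_one_le`). The first part matches the increment of `centering`, and
`1/(k+1)` matches `log(k+1) - log k`; both telescope. Hence the quotient in the theorem is exactly a
product of factors `volumeFactor k t`, `n-r ≤ k < n`, each `1 + O(k⁻²)`
(`complexMGF_centredLogVolume_div`). The product differs from `1` by a tail of a convergent series,
which vanishes as `n - r → ∞`, however many factors there are. -/

/-! ### Simplex volume as a Gram determinant. -/

lemma map_abs_volume : (volume : Measure ℝ).map (fun x => |x|) = 2 • volume.restrict (Set.Ici 0) := by
  ext s hs
  rw [Measure.map_apply (by fun_prop) hs, Measure.smul_apply, Measure.restrict_apply hs,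
    ← measure_inter_add_sdiff _ (measurableSet_Ici (a := (0 : ℝ))), two_nsmul]
  congr 1
  · congr 1
    ext x
    simp only [Set.mem_inter_iff, Set.mem_preimage, Set.mem_Ici]
    constructor <;> rintro ⟨h, h0⟩ <;> simp_all [abs_of_nonneg]
  · have : (fun x : ℝ => |x|) ⁻¹' s \ Set.Ici 0 = Neg.neg ⁻¹' (s ∩ Set.Ioi 0) := by
      ext x
      simp only [Set.mem_sdiff, Set.mem_preimage, Set.mem_Ici, not_le, Set.mem_inter_iff,
        Set.mem_Ioi, Left.neg_pos_iff]
      constructor <;> rintro ⟨h, h0⟩ <;> simp_all [abs_of_neg]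
    rw [this, Measure.measure_preimage_neg]
    exact measure_congr ((ae_eq_refl s).inter Ioi_ae_eq_Ici)

lemma map_abs_volume_pi {ι : Type*} [Fintype ι] :
    (volume : Measure (ι → ℝ)).map (fun x i => |x i|)
      = (2 ^ Fintype.card ι : ENNReal) • volume.restrict {x : ι → ℝ | ∀ i, 0 ≤ x i} := by
  have : SigmaFinite ((volume : Measure ℝ).map (fun x => |x|)) := by
    rw [map_abs_volume, two_nsmul]; infer_instance
  rw [volume_pi, Measure.pi_map_pi (fun i => by fun_prop)]
  refine Measure.pi_eq fun s hs => ?_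
  have h : {x : ι → ℝ | ∀ i, 0 ≤ x i} = Set.univ.pi fun _ => Set.Ici 0 := by
    ext; simp [Pi.le_def]
  rw [Measure.smul_apply, Measure.restrict_apply (MeasurableSet.univ_pi hs), h,
    ← Set.pi_inter_distrib, Measure.pi_pi]
  simp [map_abs_volume, Measure.smul_apply, Measure.restrict_apply, hs, Finset.prod_mul_distrib]

/-- The simplex with vertices `0` and the standard basis vectors. -/
def cornerSimplex (ι : Type*) [Fintype ι] : Set (EuclideanSpace ℝ ι) :=
  {y | (∀ i, 0 ≤ y i) ∧ ∑ i, y i ≤ 1}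

/-- Coordinatewise absolute values fold the `ℓ¹` unit ball, of volume `2^d / d!`, onto this simplex,
each of the `2^d` orthants contributing one copy. -/
lemma volume_cornerSimplex (ι : Type*) [Fintype ι] [Nonempty ι] :
    volume (cornerSimplex ι) = ENNReal.ofReal (1 / (Fintype.card ι).factorial) := by
  have h1 := volume_sum_rpow_le ι le_rfl 1
  have hmeas : MeasurableSet {x : ι → ℝ | ∑ i, x i ≤ 1} :=
    measurableSet_le (by fun_prop) measurable_const
  have h2 : volume {x : ι → ℝ | (∑ i, |x i| ^ (1 : ℝ)) ^ (1 / (1 : ℝ)) ≤ 1}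
      = 2 ^ Fintype.card ι * volume (cornerSimplex ι) := by
    calc _ = (volume : Measure (ι → ℝ)).map (fun x i => |x i|) {x : ι → ℝ | ∑ i, x i ≤ 1} := by
          rw [Measure.map_apply (by fun_prop) hmeas]
          simp
      _ = 2 ^ Fintype.card ι * volume ({x : ι → ℝ | ∑ i, x i ≤ 1} ∩ {x | ∀ i, 0 ≤ x i}) := by
          rw [map_abs_volume_pi, Measure.smul_apply, Measure.restrict_apply hmeas, smul_eq_mul]
      _ = _ := by
          rw [← (EuclideanSpace.volume_preserving_symm_measurableEquiv_toLp
            ι).measure_preimage_equiv]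
          congr 2
          ext x
          simp [cornerSimplex, and_comm]
  rw [h2] at h1
  have h3 : (2 : ENNReal) ^ Fintype.card ι ≠ 0 := by positivity
  have h4 : (2 : ENNReal) ^ Fintype.card ι ≠ ⊤ := by finiteness
  rw [← ENNReal.mul_right_inj h3 h4, h1]
  have h5 : (2 : ENNReal) ^ Fintype.card ι = ENNReal.ofReal (2 ^ Fintype.card ι) := by
    simp [ENNReal.ofReal_pow]
  rw [h5, ← ENNReal.ofReal_mul (by positivity), div_one, div_one, one_add_one_eq_two,
    Real.Gamma_two, Real.Gamma_nat_eq_factorial, mul_one, ENNReal.ofReal_one, one_pow, one_mul,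
    mul_one_div]

lemma convexHull_range_eq_image_cornerSimplex {E : Type*} [AddCommGroup E] [Module ℝ E]
    {r : ℕ} (x : Fin (r + 1) → E) :
    convexHull ℝ (Set.range x)
      = (fun y => y + x 0) '' ((fun y : EuclideanSpace ℝ (Fin r) =>
          ∑ i, y i • (x i.succ - x 0)) '' cornerSimplex (Fin r)) := by
  have h1 : Set.range x = (Fintype.linearCombination ℝ x) ''
      Set.range fun i => (Pi.single i 1 : Fin (r + 1) → ℝ) := by
    rw [← Set.range_comp]
    congr 1
    ext i
    simp
  rw [h1, ← LinearMap.image_convexHull, convexHull_rangle_single_eq_stdSimplex, Set.image_image]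
  ext v
  constructor
  · rintro ⟨w, ⟨hw0, hw1⟩, rfl⟩
    rw [Fin.sum_univ_succ] at hw1
    refine ⟨WithLp.toLp 2 fun i => w i.succ, ⟨fun i => hw0 _, ?_⟩, ?_⟩
    · have := hw0 0
      simp only
      linarith
    · have : w 0 = 1 - ∑ i : Fin r, w i.succ := by linarith
      simp only [Fintype.linearCombination_apply, Fin.sum_univ_succ, smul_sub,
        Finset.sum_sub_distrib, this, sub_smul, Finset.sum_smul, one_smul]
      abel
  · rintro ⟨y, ⟨hy0, hy1⟩, rfl⟩
    refine ⟨Fin.cons (1 - ∑ i, y i) fun i => y i, ⟨fun i => ?_, ?_⟩, ?_⟩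
    · refine Fin.cases ?_ (fun i => ?_) i
      · simpa using hy1
      · simpa using hy0 i
    · simp [Fin.sum_univ_succ]
    · simp only [Fintype.linearCombination_apply, Fin.sum_univ_succ, smul_sub,
        Finset.sum_sub_distrib, sub_smul, Finset.sum_smul, one_smul, Fin.cons_zero, Fin.cons_succ]
      abel

/-- The simplex is a translate of a linear image of `cornerSimplex`; the linear map scales
`r`-volume by its `normDet`, whose square is the Gram determinant, and the factorial cancels the
volume of the corner simplex. -/
lemma factorial_mul_simplexVolume {n r : ℕ} (hr : 1 ≤ r)
    (x : Fin (r + 1) → EuclideanSpace ℝ (Fin n)) :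
    (r.factorial : ℝ) * simplexVolume x
      = √(Matrix.gram ℝ fun i : Fin r => x i.succ - x 0).det := by
  have : NeZero r := ⟨by omega⟩
  let f : EuclideanSpace ℝ (Fin r) →ₗ[ℝ] EuclideanSpace ℝ (Fin n) :=
    (EuclideanSpace.basisFun (Fin r) ℝ).toBasis.constr ℝ fun i : Fin r => x i.succ - x 0
  have hf : ∀ y, f y = ∑ i, y i • (x i.succ - x 0) := fun y => by
    simp [f, Module.Basis.constr_apply_fintype]
  have hfd := f.normDet_sq_eq_det_gram (EuclideanSpace.basisFun (Fin r) ℝ)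
  have hv : μHE[r] (convexHull ℝ (Set.range x))
      = ENNReal.ofReal f.normDet * ENNReal.ofReal (1 / r.factorial) := by
    have h := f.euclideanHausdorffMeasure_image_eq_normDet_mul_volume (cornerSimplex (Fin r))
    rw [finrank_euclideanSpace_fin, volume_cornerSimplex, Fintype.card_fin] at h
    rw [convexHull_range_eq_image_cornerSimplex,
      show (fun y => y + x 0) = IsometryEquiv.addRight (x 0) from rfl,
      (IsometryEquiv.addRight (x 0)).isometry.euclideanHausdorffMeasure_image, ← h]
    congr 2
    exact funext fun y => (hf y).symm
  have hg : (Matrix.gram ℝ fun i : Fin r => x i.succ - x 0).det = f.normDet ^ 2 := by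
    rw [show f.normDet ^ 2 = _ from hfd]
    congr 2
    ext1 i
    simp [hf]
  rw [simplexVolume, hv, hg, Real.sqrt_sq f.normDet_nonneg, ENNReal.toReal_mul,
    ENNReal.toReal_ofReal f.normDet_nonneg, ENNReal.toReal_ofReal (by positivity)]
  field_simp

/-! ### Orthogonal mixing of the sample points. -/

section Rotation

variable {E : Type*} [NormedAddCommGroup E] [InnerProductSpace ℝ E]

lemma gram_sum_smul {ι κ : Type*} [Fintype κ] (M : Matrix ι κ ℝ) (z : κ → E) :
    Matrix.gram ℝ (fun i => ∑ k, M i k • z k) = M * Matrix.gram ℝ z * M.transpose := by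
  ext i j
  simp only [Matrix.gram_apply, Matrix.mul_apply, Matrix.transpose_apply, sum_inner, inner_sum,
    real_inner_smul_left, real_inner_smul_right, Finset.sum_mul]
  refine Finset.sum_congr rfl fun k _ => Finset.sum_congr rfl fun l _ => by ring

variable {ι : Type*} [Fintype ι]

/-- The family whose `i`-th member is the combination of the `x j` with the coordinates of `b i`
as coefficients. -/
def rotate (b : ι → EuclideanSpace ℝ ι) (x : ι → E) (i : ι) : E := ∑ j, b i j • x j

lemma sum_mul_apply [DecidableEq ι] (b : OrthonormalBasis ι ℝ (EuclideanSpace ℝ ι)) (j k : ι) :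
    ∑ i, b i j * b i k = if j = k then 1 else 0 := by
  have h := b.sum_inner_mul_inner (EuclideanSpace.single j (1 : ℝ)) (EuclideanSpace.single k 1)
  simpa [EuclideanSpace.inner_single_left, EuclideanSpace.inner_single_right, eq_comm] using h

lemma sum_smul_rotate [DecidableEq ι] (b : OrthonormalBasis ι ℝ (EuclideanSpace ℝ ι))
    (x : ι → E) (j : ι) : ∑ i, b i j • rotate b x i = x j := by
  simp_rw [rotate, Finset.smul_sum, smul_smul]
  rw [Finset.sum_comm]
  simp_rw [← Finset.sum_smul, sum_mul_apply]
  simp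

lemma exists_orthonormalBasis_const (r : ℕ) :
    ∃ b : OrthonormalBasis (Fin (r + 1)) ℝ (EuclideanSpace ℝ (Fin (r + 1))),
      ∀ j k, b 0 j = b 0 k := by
  obtain ⟨b, hb⟩ := Orthonormal.exists_orthonormalBasis_extension_of_card_eq (𝕜 := ℝ)
    (E := EuclideanSpace ℝ (Fin (r + 1))) (ι := Fin (r + 1)) (by simp)
    (v := fun _ => WithLp.toLp 2 fun _ => 1 / √(r + 1)) (s := {0}) (by
      rw [orthonormal_iff_ite]
      rintro ⟨i, rfl⟩ ⟨j, rfl⟩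
      have h : (0 : ℝ) ≤ r + 1 := by positivity
      have h' : (r + 1 : ℝ) ≠ 0 := by positivity
      simp [Set.domRestrict, EuclideanSpace.norm_eq, Real.sq_sqrt h, h'])
  exact ⟨b, fun j k => by simp [hb 0 rfl]⟩

/-- Since `b 0` is constant, the component along `rotate b x 0` cancels in every difference. The
remaining coefficient matrix satisfies `M Mᵀ = 1 + 𝟙𝟙ᵀ`, of determinant `r + 1`. -/
lemma det_gram_sub_eq {r : ℕ} (b : OrthonormalBasis (Fin (r + 1)) ℝ (EuclideanSpace ℝ (Fin (r + 1))))
    (hb : ∀ j k, b 0 j = b 0 k) (x : Fin (r + 1) → E) :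
    (Matrix.gram ℝ fun i : Fin r => x i.succ - x 0).det
      = (r + 1) * (Matrix.gram ℝ fun i : Fin r => rotate b x i.succ).det := by
  let M : Matrix (Fin r) (Fin r) ℝ := Matrix.of fun j i => b i.succ j.succ - b i.succ 0
  have hM : M * M.transpose
      = 1 + Matrix.replicateCol Unit (fun _ : Fin r => (1 : ℝ)) *
        Matrix.replicateRow Unit (fun _ : Fin r => (1 : ℝ)) := by
    ext j k
    have h : ∀ p q, ∑ i : Fin r, b i.succ p * b i.succ q = (if p = q then 1 else 0) - b 0 0 * b 0 0 := by
      intro p q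
      rw [← sum_mul_apply b, Fin.sum_univ_succ, hb p 0, hb q 0]
      ring
    simp only [M, Matrix.mul_apply, Matrix.of_apply, Matrix.transpose_apply, sub_mul, mul_sub,
      Finset.sum_sub_distrib, h, Matrix.add_apply, Matrix.one_apply]
    simp [Fin.succ_ne_zero, (Fin.succ_ne_zero _).symm]
    ring
  have hx : (fun i : Fin r => x i.succ - x 0) = fun j => ∑ i, M j i • rotate b x i.succ := by
    ext1 j
    rw [← sum_smul_rotate b x j.succ, ← sum_smul_rotate b x 0, Fin.sum_univ_succ,
      Fin.sum_univ_succ, hb j.succ 0, add_sub_add_left_eq_sub, ← Finset.sum_sub_distrib]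
    simp [M, sub_smul]
  rw [hx, gram_sum_smul, Matrix.det_mul, Matrix.det_mul, mul_right_comm, ← Matrix.det_mul, hM,
    Matrix.det_one_add_replicateCol_mul_replicateRow]
  simp [dotProduct, add_comm]

variable [FiniteDimensional ℝ E] [MeasurableSpace E] [BorelSpace E]

lemma map_rotate_pi_stdGaussian [DecidableEq ι] (b : OrthonormalBasis ι ℝ (EuclideanSpace ℝ ι)) :
    (Measure.pi fun _ : ι => stdGaussian E).map (rotate b) = Measure.pi fun _ => stdGaussian E := by
  have hmeas : Measurable (rotate b : (ι → E) → ι → E) := by unfold rotate; fun_prop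
  have : IsProbabilityMeasure ((Measure.pi fun _ : ι => stdGaussian E).map (rotate b)) :=
    Measure.isProbabilityMeasure_map hmeas.aemeasurable
  -- The plain product carries the sup norm; passing to `PiLp 2` supplies the inner product that
  -- characteristic functions need.
  have hinj : ∀ μ ν : Measure (ι → E), μ.map (WithLp.toLp 2) = ν.map (WithLp.toLp 2) → μ = ν := by
    intro μ ν h
    exact (MeasurableEquiv.toLp 2 (ι → E)).map_measurableEquiv_injective h
  apply hinj
  have h1 : IsProbabilityMeasure ((Measure.pi fun _ : ι => stdGaussian E).map
    (WithLp.toLp 2)) := Measure.isProbabilityMeasure_map (by fun_prop)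
  have h2 : IsProbabilityMeasure (((Measure.pi fun _ : ι => stdGaussian E).map (rotate b)).map
    (WithLp.toLp 2)) := Measure.isProbabilityMeasure_map (by fun_prop)
  have hnorm : ∀ t : PiLp 2 (fun _ : ι => E),
      charFun ((Measure.pi fun _ : ι => stdGaussian E).map (WithLp.toLp 2)) t
        = Complex.exp (-((∑ i, ‖t i‖ ^ 2 : ℝ) : ℂ) / 2) := by
    intro t
    simp_rw [charFun_pi, charFun_stdGaussian, ← Complex.exp_sum]
    push_cast
    rw [neg_div, Finset.sum_div, ← Finset.sum_neg_distrib]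
    simp_rw [neg_div]
  refine Measure.ext_of_charFun ?_
  ext t
  rw [hnorm t, charFun_apply, integral_map (by fun_prop) (by fun_prop),
    integral_map (by fun_prop) (by fun_prop)]
  -- `s` is the transposed rotation of `t`. It has the same norm, and the Gaussian characteristic
  -- function depends on the norm only.
  let s : PiLp 2 (fun _ : ι => E) := WithLp.toLp 2 fun j => ∑ i, b i j • t i
  have hs : ∀ x : ι → E, inner ℝ (WithLp.toLp 2 (rotate b x)) t = inner ℝ (WithLp.toLp 2 x) s := by
    intro x
    simp only [PiLp.inner_apply, s, rotate, sum_inner, inner_sum, real_inner_smul_left,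
      real_inner_smul_right]
    rw [Finset.sum_comm]
  have hs2 : ∑ i, ‖s i‖ ^ 2 = ∑ i, ‖t i‖ ^ 2 := by
    have h : ∀ k, ∑ j, b k j • s j = t k := by
      intro k
      simp only [s, Finset.smul_sum, smul_smul]
      rw [Finset.sum_comm]
      simp_rw [← Finset.sum_smul]
      have : ∀ i, ∑ j, b k j * b i j = if k = i then 1 else 0 := fun i => by
        have := orthonormal_iff_ite.1 b.orthonormal i k
        simpa [PiLp.inner_apply, eq_comm] using this
      simp [this]
    simp_rw [← real_inner_self_eq_norm_sq]
    calc ∑ j, inner ℝ (s j) (s j) = ∑ j, ∑ i, b i j * inner ℝ (t i) (s j) := by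
          refine Finset.sum_congr rfl fun j _ => ?_
          conv_lhs => arg 2; rw [show s j = ∑ i, b i j • t i from rfl]
          simp [sum_inner, real_inner_smul_left]
      _ = ∑ i, inner ℝ (t i) (∑ j, b i j • s j) := by
          rw [Finset.sum_comm]
          simp [inner_sum, real_inner_smul_right]
      _ = _ := by simp_rw [h]
  simp_rw [hs]
  rw [← integral_map (μ := Measure.pi fun _ : ι => stdGaussian E) (φ := WithLp.toLp 2)
    (f := fun y => Complex.exp ((inner ℝ y s : ℝ) * Complex.I)) (by fun_prop) (by fun_prop),
    ← charFun_apply, hnorm, hs2]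

end Rotation

/-! ### Density, projections and norm moments of the standard Gaussian. -/

section StdGaussian

variable {W : Type*} [NormedAddCommGroup W] [InnerProductSpace ℝ W] [FiniteDimensional ℝ W]
  [MeasurableSpace W] [BorelSpace W]

lemma stdGaussian_eq_withDensity :
    stdGaussian W = volume.withDensity fun x => ENNReal.ofReal
      ((2 * Real.pi) ^ (-(Module.finrank ℝ W / 2 : ℝ)) * Real.exp (-(1 / 2) * ‖x‖ ^ 2)) := by
  set c : ℝ := (2 * Real.pi) ^ (-(Module.finrank ℝ W / 2 : ℝ)) with hc
  have hc0 : 0 < c := by positivity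
  have hint : Integrable fun x : W => c * Real.exp (-(1 / 2) * ‖x‖ ^ 2) := by
    have := (GaussianFourier.integrable_cexp_neg_mul_sq_norm_add (V := W) (b := (1 / 2 : ℝ))
      (by norm_num) 0 0).re
    refine (this.congr (ae_of_all _ fun x => ?_)).const_mul c
    simp only [zero_mul, add_zero]
    rw [← Complex.ofReal_neg, ← Complex.ofReal_pow, ← Complex.ofReal_mul, ← Complex.ofReal_exp]
    rfl
  have : IsFiniteMeasure (volume.withDensity fun x : W => ENNReal.ofReal
      (c * Real.exp (-(1 / 2) * ‖x‖ ^ 2))) :=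
    isFiniteMeasure_withDensity_ofReal hint.2
  refine Measure.ext_of_charFun ?_
  ext t
  rw [charFun_stdGaussian, charFun_apply, integral_withDensity_eq_integral_toReal_smul
    (by fun_prop) (by simp)]
  have h := GaussianFourier.integral_cexp_neg_mul_sq_norm_add (V := W) (b := (1 / 2 : ℝ))
      (by norm_num) Complex.I t
  have h2 : ∀ x : W, (ENNReal.ofReal (c * Real.exp (-(1 / 2) * ‖x‖ ^ 2))).toReal •
      Complex.exp (↑(inner ℝ x t) * Complex.I)
      = c * Complex.exp (-((1 / 2 : ℝ) : ℂ) * ‖x‖ ^ 2 + Complex.I * (inner ℝ t x : ℝ)) := fun x => by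
    rw [ENNReal.toReal_ofReal (by positivity), Complex.exp_add, Complex.real_smul,
      real_inner_comm x t, mul_comm Complex.I]
    push_cast
    ring
  simp_rw [h2]
  rw [integral_const_mul, h]
  have h3 : (Real.pi / ((1 / 2 : ℝ) : ℂ)) ^ (Module.finrank ℝ W / 2 : ℂ)
      = ((2 * Real.pi) ^ (Module.finrank ℝ W / 2 : ℝ) : ℝ) := by
    rw [Complex.ofReal_cpow (by positivity)]
    push_cast
    congr 1
    field_simp
  have h4 : c * (2 * Real.pi) ^ (Module.finrank ℝ W / 2 : ℝ) = 1 := by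
    rw [hc, ← Real.rpow_add (by positivity)]
    simp
  rw [h3, ← mul_assoc, ← Complex.ofReal_mul, h4]
  simp only [Complex.ofReal_one, one_mul, Complex.I_sq]
  congr 1
  push_cast
  ring

lemma stdGaussian_map_orthogonalProjectionOnto (K : Submodule ℝ W) :
    (stdGaussian W).map K.orthogonalProjectionOnto = stdGaussian K := by
  have : IsProbabilityMeasure ((stdGaussian W).map K.orthogonalProjectionOnto) :=
    Measure.isProbabilityMeasure_map (by fun_prop)
  refine Measure.ext_of_charFun ?_
  ext t
  rw [charFun_stdGaussian, charFun_apply, integral_map (by fun_prop) (by fun_prop)]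
  have : ∀ x : W, inner ℝ (K.orthogonalProjectionOnto x) t = inner ℝ x (t : W) := fun x => by
    simp
  simp_rw [this]
  rw [← charFun_apply, charFun_stdGaussian]
  simp

/-- The Mellin-type transform `E ‖ξ‖ ^ t` of a standard Gaussian vector `ξ` in dimension `d`. -/
noncomputable def chiMGF (d : ℕ) (t : ℂ) : ℂ :=
  (2 : ℂ) ^ (t / 2) * Complex.Gamma ((d + t) / 2) / Complex.Gamma (d / 2)

/-- The substitution `u = y²` turns this into an Euler integral for Gamma. -/
lemma integral_cpow_mul_exp_neg_sq {s : ℂ} (hs : 0 < s.re) :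
    ∫ y : ℝ in Set.Ioi 0, (y : ℂ) ^ (s - 1) * Complex.exp (-(1 / 2) * (y : ℂ) ^ 2)
      = 2⁻¹ * ((2 : ℂ) ^ (s / 2) * Complex.Gamma (s / 2)) := by
  have h1 := mellin_comp_rpow (fun u : ℝ => Complex.exp (-(((1 / 2 : ℝ) : ℂ) * u))) s 2
  have h2 : mellin (fun u : ℝ => Complex.exp (-(((1 / 2 : ℝ) : ℂ) * u))) (s / (2 : ℝ))
      = (2 : ℂ) ^ (s / 2) * Complex.Gamma (s / 2) := by
    rw [mellin]
    simp_rw [smul_eq_mul]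
    rw [Complex.integral_cpow_mul_exp_neg_mul_Ioi (by simpa using hs) (by norm_num)]
    norm_num
  rw [h2, mellin] at h1
  rw [show (2⁻¹ : ℂ) * ((2 : ℂ) ^ (s / 2) * Complex.Gamma (s / 2))
    = |(2 : ℝ)|⁻¹ • ((2 : ℂ) ^ (s / 2) * Complex.Gamma (s / 2)) by simp, ← h1]
  congr 1
  ext y
  simp

lemma integrableOn_cpow_mul_exp_neg_sq {s : ℂ} (hs : 0 < s.re) :
    IntegrableOn (fun y : ℝ => (y : ℂ) ^ (s - 1) * Complex.exp (-(1 / 2) * (y : ℂ) ^ 2))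
      (Set.Ioi 0) := by
  have h := integrableOn_rpow_mul_exp_neg_mul_sq (b := 1 / 2) (by norm_num) (s := s.re - 1)
    (by linarith)
  refine (integrable_norm_iff ?_).1 (h.congr_fun (fun y hy => ?_) measurableSet_Ioi)
  · refine (ContinuousOn.aestronglyMeasurable ?_ measurableSet_Ioi)
    refine ContinuousOn.mul (fun y hy => ?_) (by fun_prop)
    exact (Complex.continuousAt_ofReal_cpow_const y _ (Or.inr (ne_of_gt hy))).continuousWithinAt
  · simp only [norm_mul]
    rw [Complex.norm_cpow_eq_rpow_re_of_pos hy, Complex.norm_exp]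
    simp [← Complex.ofReal_pow]

lemma chi_moment (hd : 0 < Module.finrank ℝ W) {t : ℂ} (ht : -(Module.finrank ℝ W : ℝ) < t.re) :
    Integrable (fun x : W => Complex.exp (t * Real.log ‖x‖)) (stdGaussian W) ∧
    ∫ x : W, Complex.exp (t * Real.log ‖x‖) ∂stdGaussian W = chiMGF (Module.finrank ℝ W) t := by
  have : Nontrivial W := Module.finrank_pos_iff.1 hd
  set d := Module.finrank ℝ W with hdd
  set c : ℝ := (2 * Real.pi) ^ (-(d / 2 : ℝ)) with hc
  -- Polar coordinates give the moment up to a constant free of `t`. That constant is never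
  -- evaluated: the case `t = 0`, where the integral is the total mass `1`, eliminates it.
  have key : ∀ t : ℂ, -(d : ℝ) < t.re →
      Integrable (fun x : W => Complex.exp (t * Real.log ‖x‖)) (stdGaussian W) ∧
      ∫ x : W, Complex.exp (t * Real.log ‖x‖) ∂stdGaussian W
        = d * (volume : Measure W).real (Metric.ball 0 1) * c * 2⁻¹ *
          ((2 : ℂ) ^ ((d + t) / 2) * Complex.Gamma ((d + t) / 2)) := by
    intro t ht
    have hre : 0 < (d + t : ℂ).re := by simp; linarith
    have h1 : ∀ x : W, (ENNReal.ofReal (c * Real.exp (-(1 / 2) * ‖x‖ ^ 2))).toReal •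
        Complex.exp (t * Real.log ‖x‖) = (fun y : ℝ => (c : ℂ) * Complex.exp (-(1 / 2) * (y : ℂ) ^ 2) *
          Complex.exp (t * Real.log y)) ‖x‖ := fun x => by
      rw [ENNReal.toReal_ofReal (by positivity), Complex.real_smul]
      push_cast
      rfl
    have h2 : ∀ y ∈ Set.Ioi (0 : ℝ), y ^ (d - 1) • ((c : ℂ) * Complex.exp (-(1 / 2) * (y : ℂ) ^ 2) *
          Complex.exp (t * Real.log y))
        = c * ((y : ℂ) ^ ((d + t : ℂ) - 1) * Complex.exp (-(1 / 2) * (y : ℂ) ^ 2)) := by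
      intro y hy
      have hy0 : (y : ℂ) ≠ 0 := by exact_mod_cast (ne_of_gt hy)
      rw [show (d + t : ℂ) - 1 = ((d - 1 : ℕ) : ℂ) + t by push_cast [Nat.cast_sub hd]; ring,
        Complex.cpow_add _ _ hy0, Complex.cpow_natCast, Complex.cpow_def_of_ne_zero hy0,
        Complex.ofReal_log (le_of_lt hy), Complex.real_smul, mul_comm t]
      push_cast
      ring
    rw [stdGaussian_eq_withDensity]
    constructor
    · rw [integrable_withDensity_iff_integrable_smul' (by fun_prop) (by simp)]
      simp_rw [← hdd, ← hc, h1]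
      rw [integrable_fun_norm_addHaar volume (f := fun y : ℝ =>
        (c : ℂ) * Complex.exp (-(1 / 2) * (y : ℂ) ^ 2) * Complex.exp (t * Real.log y))]
      exact (IntegrableOn.congr_fun ((integrableOn_cpow_mul_exp_neg_sq hre).const_mul (c : ℂ))
        (fun y hy => (h2 y hy).symm) measurableSet_Ioi)
    · rw [integral_withDensity_eq_integral_toReal_smul (by fun_prop) (by simp)]
      simp_rw [← hdd, ← hc, h1]
      rw [integral_fun_norm_addHaar volume (fun y : ℝ =>
        (c : ℂ) * Complex.exp (-(1 / 2) * (y : ℂ) ^ 2) * Complex.exp (t * Real.log y)), setIntegral_congr_fun measurableSet_Ioi h2,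
        integral_const_mul, integral_cpow_mul_exp_neg_sq hre, ← hdd]
      simp only [nsmul_eq_mul, Complex.real_smul]
      ring
  refine ⟨(key t ht).1, ?_⟩
  have h0 := (key 0 (by simpa using hd)).2
  simp only [zero_mul, Complex.exp_zero, integral_const, probReal_univ, one_smul, add_zero] at h0
  have hG : Complex.Gamma (d / 2) ≠ 0 :=
    Complex.Gamma_ne_zero_of_re_pos (by simpa using hd)
  rw [(key t ht).2, chiMGF, add_div, Complex.cpow_add _ _ two_ne_zero, eq_div_iff hG]
  calc _ = (d * (volume : Measure W).real (Metric.ball 0 1) * c * 2⁻¹ *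
        ((2 : ℂ) ^ (d / 2 : ℂ) * Complex.Gamma (d / 2))) *
        ((2 : ℂ) ^ (t / 2) * Complex.Gamma (d / 2 + t / 2)) := by ring
    _ = _ := by rw [← h0, one_mul]

lemma ae_ne_zero_stdGaussian (hd : 0 < Module.finrank ℝ W) : ∀ᵐ x ∂stdGaussian W, x ≠ 0 := by
  have : Nontrivial W := Module.finrank_pos_iff.1 hd
  rw [stdGaussian_eq_withDensity]
  exact (withDensity_absolutelyContinuous _ _).ae_le (Measure.ae_ne volume 0)

end StdGaussian

/-! ### Moments of a Gaussian Gram determinant. -/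

section GramMoments

variable {E : Type*} [NormedAddCommGroup E] [InnerProductSpace ℝ E]

lemma det_gram_cons_of_orthogonal {r : ℕ} (z : Fin r → E) (q : E)
    (hq : ∀ i, inner ℝ q (z i) = 0) :
    (Matrix.gram ℝ (Fin.cons q z : Fin (r + 1) → E)).det = ‖q‖ ^ 2 * (Matrix.gram ℝ z).det := by
  rw [Matrix.det_succ_row_zero, Fin.sum_univ_succ]
  simp only [Matrix.gram_apply, Fin.cons_zero, Fin.cons_succ, hq]
  simp
  left
  rfl

lemma det_gram_nonneg {r : ℕ} (z : Fin r → E) : 0 ≤ (Matrix.gram ℝ z).det :=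
  (Matrix.posSemidef_gram ℝ z).det_nonneg

variable [FiniteDimensional ℝ E]

/-- Subtracting from `x` its part in the span of `z` is a unipotent change of family, so the
determinant is unchanged and the Gram matrix becomes block diagonal. -/
lemma det_gram_cons {r : ℕ} (z : Fin r → E) (x : E) :
    (Matrix.gram ℝ (Fin.cons x z : Fin (r + 1) → E)).det
      = ‖(Submodule.span ℝ (Set.range z))ᗮ.orthogonalProjectionOnto x‖ ^ 2
        * (Matrix.gram ℝ z).det := by
  set K := Submodule.span ℝ (Set.range z) with hK
  set q : E := Kᗮ.orthogonalProjectionOnto x with hqdef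
  have hp : x - q ∈ K := by
    have := Submodule.sub_starProjection_mem_orthogonal (K := Kᗮ) x
    rwa [Submodule.orthogonal_orthogonal] at this
  obtain ⟨c, hc⟩ := (Submodule.mem_span_range_iff_exists_fun ℝ).1 hp
  have hq : ∀ i, inner ℝ q (z i) = 0 := fun i =>
    Submodule.inner_left_of_mem_orthogonal (K := K) (Submodule.subset_span (Set.mem_range_self i))
      (Submodule.coe_mem (Kᗮ.orthogonalProjectionOnto x))
  let M : Matrix (Fin (r + 1)) (Fin (r + 1)) ℝ :=
    Fin.cons (Fin.cons 1 c) fun i => Fin.cons 0 (Pi.single i 1)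
  have hM : M.det = 1 := by
    rw [Matrix.det_succ_column_zero, Fin.sum_univ_succ]
    have : M.submatrix (Fin.succAbove 0) Fin.succ = 1 := by
      ext i j
      rw [Matrix.submatrix_apply, Fin.zero_succAbove]
      change (Pi.single i 1 : Fin r → ℝ) j = _
      rw [Matrix.one_apply, Pi.single_apply]
      simp [eq_comm]
    simp [M] at this ⊢
    rw [this, Matrix.det_one]
  have hx : (Fin.cons x z : Fin (r + 1) → E)
      = fun i => ∑ k, M i k • (Fin.cons q z : Fin (r + 1) → E) k := by
    ext1 i
    refine Fin.cases ?_ (fun i => ?_) i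
    · simp [M, Fin.sum_univ_succ, hc]
    · simp [M, Fin.sum_univ_succ, Pi.single_apply]
  rw [hx, gram_sum_smul, Matrix.det_mul, Matrix.det_mul, Matrix.det_transpose, hM, one_mul, mul_one,
    det_gram_cons_of_orthogonal z q hq, Submodule.coe_norm]

lemma finrank_orthogonal_span {r : ℕ} {z : Fin r → E} (hz : (Matrix.gram ℝ z).det ≠ 0) :
    Module.finrank ℝ (Submodule.span ℝ (Set.range z))ᗮ = Module.finrank ℝ E - r := by
  have h1 := Submodule.finrank_add_finrank_orthogonal (Submodule.span ℝ (Set.range z))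
  rw [finrank_span_eq_card (Matrix.det_gram_ne_zero_iff_linearIndependent.1 hz),
    Fintype.card_fin] at h1
  omega

variable [MeasurableSpace E]

omit [FiniteDimensional ℝ E] in
lemma det_gram_eq_tail_head {r : ℕ} (z : Fin (r + 1) → E) :
    (Matrix.gram ℝ z).det = (fun p : (Fin r → E) × E => (Matrix.gram ℝ
      (Fin.cons p.2 p.1 : Fin (r + 1) → E)).det)
      (((MeasurableEquiv.piFinSuccAbove (fun _ : Fin (r + 1) => E) 0).trans
      MeasurableEquiv.prodComm) z) := by
  have : z = Fin.cons (z 0) (Fin.tail z) := (Fin.cons_self_tail z).symm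
  conv_lhs => rw [this]
  rfl

variable [BorelSpace E]

@[fun_prop]
lemma measurable_det_gram {r : ℕ} : Measurable fun z : Fin r → E => (Matrix.gram ℝ z).det := by
  refine Continuous.measurable (Continuous.matrix_det ?_)
  refine continuous_matrix fun i j => ?_
  simp only [Matrix.gram_apply]
  fun_prop

lemma measurePreserving_tail_head (r : ℕ) :
    MeasurePreserving ((MeasurableEquiv.piFinSuccAbove (fun _ : Fin (r + 1) => E) 0).trans
      MeasurableEquiv.prodComm) (Measure.pi fun _ => stdGaussian E)
      ((Measure.pi fun _ : Fin r => stdGaussian E).prod (stdGaussian E)) :=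
  (measurePreserving_piFinSuccAbove (fun _ : Fin (r + 1) => stdGaussian E) 0).trans
    Measure.measurePreserving_swap

lemma measurable_det_gram_cons {r : ℕ} : Measurable fun p : (Fin r → E) × E =>
    (Matrix.gram ℝ (Fin.cons p.2 p.1 : Fin (r + 1) → E)).det := by
  refine measurable_det_gram.comp (measurable_pi_lambda _ fun i => ?_)
  refine Fin.cases ?_ (fun i => ?_) i
  · simpa using measurable_snd
  · simp only [Fin.cons_succ]; fun_prop

/-- This makes the value `Real.log 0 = 0` harmless and lets logarithms of products be split almost
everywhere. -/
lemma ae_det_gram_ne_zero {r : ℕ} (hr : r ≤ Module.finrank ℝ E) :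
    ∀ᵐ z ∂(Measure.pi fun _ : Fin r => stdGaussian E), (Matrix.gram ℝ z).det ≠ 0 := by
  induction r with
  | zero => simp
  | succ r ih =>
    have h : ∀ᵐ p ∂((Measure.pi fun _ : Fin r => stdGaussian E).prod (stdGaussian E)),
        (Matrix.gram ℝ (Fin.cons p.2 p.1 : Fin (r + 1) → E)).det ≠ 0 := by
      refine (Measure.ae_prod_iff_ae_ae (p := fun p : (Fin r → E) × E =>
        (Matrix.gram ℝ (Fin.cons p.2 p.1 : Fin (r + 1) → E)).det ≠ 0)
        (measurable_det_gram_cons (measurableSet_singleton 0).compl)).2 ?_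
      filter_upwards [ih (by omega)] with z hz
      have h1 := ae_ne_zero_stdGaussian (W := ((Submodule.span ℝ (Set.range z))ᗮ : Submodule ℝ E))
        (by rw [finrank_orthogonal_span hz]; omega)
      rw [← stdGaussian_map_orthogonalProjectionOnto] at h1
      filter_upwards [ae_of_ae_map (by fun_prop) h1] with x hx
      rw [det_gram_cons]
      exact mul_ne_zero (pow_ne_zero 2 (norm_ne_zero_iff.2 hx)) hz
    filter_upwards [(measurePreserving_tail_head r).quasiMeasurePreserving.ae h] with z hz
    rwa [det_gram_eq_tail_head]

lemma chi_moment_projection {r : ℕ} (hr : r + 1 ≤ Module.finrank ℝ E) {z : Fin r → E}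
    (hz : (Matrix.gram ℝ z).det ≠ 0) {t : ℂ} (ht : -((Module.finrank ℝ E : ℝ) - r) < t.re) :
    Integrable (fun x => Complex.exp (t * Real.log
      √(Matrix.gram ℝ (Fin.cons x z : Fin (r + 1) → E)).det)) (stdGaussian E) ∧
    ∫ x, Complex.exp (t * Real.log
      √(Matrix.gram ℝ (Fin.cons x z : Fin (r + 1) → E)).det) ∂stdGaussian E
      = chiMGF (Module.finrank ℝ E - r) t
        * Complex.exp (t * Real.log √(Matrix.gram ℝ z).det) := by
  set K := (Submodule.span ℝ (Set.range z))ᗮ with hK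
  have hfin : Module.finrank ℝ K = Module.finrank ℝ E - r := finrank_orthogonal_span hz
  have hpos : 0 < Module.finrank ℝ K := by omega
  obtain ⟨h1, h2⟩ := chi_moment (W := K) hpos (t := t) (by
    rw [hfin, Nat.cast_sub (by omega)]; exact ht)
  have h3 := ae_ne_zero_stdGaussian (W := K) hpos
  have hm : AEStronglyMeasurable (fun w : K => Complex.exp (t * Real.log ‖w‖))
      ((stdGaussian E).map K.orthogonalProjectionOnto) :=
    Measurable.aestronglyMeasurable (by fun_prop)
  rw [← stdGaussian_map_orthogonalProjectionOnto] at h1 h2 h3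
  rw [integrable_map_measure hm (by fun_prop)] at h1
  rw [integral_map (by fun_prop) hm] at h2
  have h4 : (fun x => Complex.exp (t * Real.log ‖K.orthogonalProjectionOnto x‖)
        * Complex.exp (t * Real.log √(Matrix.gram ℝ z).det)) =ᵐ[stdGaussian E]
      fun x => Complex.exp (t * Real.log
        √(Matrix.gram ℝ (Fin.cons x z : Fin (r + 1) → E)).det) := by
    filter_upwards [ae_of_ae_map (by fun_prop) h3] with x hx
    have hd : 0 < (Matrix.gram ℝ z).det := (det_gram_nonneg z).lt_of_ne' hz
    rw [det_gram_cons, Real.sqrt_mul (by positivity), Real.sqrt_sq (norm_nonneg _),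
      Real.log_mul (norm_ne_zero_iff.2 hx) (by positivity), ← Complex.exp_add,
      Complex.ofReal_add, mul_add]
  refine ⟨(h1.mul_const _).congr h4, ?_⟩
  rw [← integral_congr_ae h4, integral_mul_const, h2, hfin]

/-- The modulus of the integrand is the integrand at the real exponent `t.re`. This is the inner
integral required to apply Fubini. -/
lemma integral_norm_chi_moment_projection {r : ℕ} (hr : r + 1 ≤ Module.finrank ℝ E) {z : Fin r → E}
    (hz : (Matrix.gram ℝ z).det ≠ 0) {t : ℂ} (ht : -((Module.finrank ℝ E : ℝ) - r) < t.re) :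
    ∫ x, ‖Complex.exp (t * Real.log
      √(Matrix.gram ℝ (Fin.cons x z : Fin (r + 1) → E)).det)‖ ∂stdGaussian E
      = (chiMGF (Module.finrank ℝ E - r) t.re).re
        * ‖Complex.exp (t * Real.log √(Matrix.gram ℝ z).det)‖ := by
  have hn : ∀ s : ℝ, ((‖Complex.exp (t * s)‖ : ℝ) : ℂ) = Complex.exp ((t.re : ℂ) * s) := fun s => by
    simp [Complex.norm_exp]
  have h := (chi_moment_projection hr hz (t := t.re) (by simpa using ht)).2
  simp_rw [← hn] at h
  rw [integral_complex_ofReal] at h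
  have := congrArg Complex.re h
  simpa using this

theorem integral_exp_log_det_gram {r : ℕ} (hr : r ≤ Module.finrank ℝ E) {t : ℂ}
    (ht : -((Module.finrank ℝ E : ℝ) - r + 1) < t.re) :
    Integrable (fun z : Fin r → E => Complex.exp (t * Real.log √(Matrix.gram ℝ z).det))
      (Measure.pi fun _ => stdGaussian E) ∧
    ∫ z : Fin r → E, Complex.exp (t * Real.log √(Matrix.gram ℝ z).det)
      ∂(Measure.pi fun _ => stdGaussian E)
      = ∏ j ∈ Finset.range r, chiMGF (Module.finrank ℝ E - j) t := by
  induction r with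
  | zero => simp
  | succ r ih =>
    push_cast at ht
    have ht' : -((Module.finrank ℝ E : ℝ) - r) < t.re := by linarith
    obtain ⟨ih1, ih2⟩ := ih (by omega) (by linarith)
    have hae := ae_det_gram_ne_zero (E := E) (r := r) (by omega)
    have hmeas : Measurable fun p : (Fin r → E) × E => Complex.exp (t * Real.log
        √(Matrix.gram ℝ (Fin.cons p.2 p.1 : Fin (r + 1) → E)).det) := by
      have := measurable_det_gram_cons (E := E) (r := r)
      fun_prop
    have hint : Integrable (fun p : (Fin r → E) × E => Complex.exp (t * Real.log
        √(Matrix.gram ℝ (Fin.cons p.2 p.1 : Fin (r + 1) → E)).det))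
        ((Measure.pi fun _ : Fin r => stdGaussian E).prod (stdGaussian E)) := by
      rw [integrable_prod_iff hmeas.aestronglyMeasurable]
      constructor
      · filter_upwards [hae] with z hz using (chi_moment_projection hr hz ht').1
      · refine (ih1.norm.const_mul (chiMGF (Module.finrank ℝ E - r) t.re).re).congr ?_
        filter_upwards [hae] with z hz using (integral_norm_chi_moment_projection hr hz ht').symm
    have hmp := measurePreserving_tail_head (E := E) r
    let F : (Fin r → E) × E → ℂ := fun p => Complex.exp (t * Real.log
      √(Matrix.gram ℝ (Fin.cons p.2 p.1 : Fin (r + 1) → E)).det)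
    have hF : ∀ z : Fin (r + 1) → E, Complex.exp (t * Real.log √(Matrix.gram ℝ z).det)
        = F (((MeasurableEquiv.piFinSuccAbove (fun _ : Fin (r + 1) => E) 0).trans
          MeasurableEquiv.prodComm) z) := fun z =>
      congrArg (fun d : ℝ => Complex.exp (t * Real.log √d)) (det_gram_eq_tail_head z)
    simp only [hF]
    refine ⟨(hmp.integrable_comp_emb (MeasurableEquiv.measurableEmbedding _)).2 hint, ?_⟩
    rw [hmp.integral_comp' (g := F), integral_prod _ hint,
      integral_congr_ae (g := fun z => chiMGF (Module.finrank ℝ E - r) t *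
        Complex.exp (t * Real.log √(Matrix.gram ℝ z).det)), integral_const_mul, ih2,
      Finset.prod_range_succ, mul_comm]
    filter_upwards [hae] with z hz using (chi_moment_projection hr hz ht').2

end GramMoments

/-! ### Uniform asymptotics of `Γ(z + a) / Γ(z)`. -/

section GammaRatio

open Topology

/-- The ratio `Γ (z + a) / Γ z` divided by its second order asymptotic expansion. -/
noncomputable def gammaRatio (a : ℂ) (z : ℝ) : ℂ :=
  Complex.Gamma (z + a) / Complex.Gamma z *
    Complex.exp (-(a * Real.log z + a * (a - 1) / (2 * z)))

/-- The logarithm of `gammaRatio a (z + 1) / gammaRatio a z`. -/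
noncomputable def gammaRatioStep (a : ℂ) (z : ℝ) : ℂ :=
  Complex.log (1 + a / z) - a * Real.log (1 + 1 / z) - a * (a - 1) / 2 * (1 / (z + 1) - 1 / z)

lemma norm_log_one_add_sub_le {x : ℂ} (hx : ‖x‖ ≤ 1 / 2) :
    ‖Complex.log (1 + x) - (x - x ^ 2 / 2)‖ ≤ ‖x‖ ^ 3 := by
  have h := Complex.norm_log_sub_logTaylor_le 2 (z := x) (by linarith)
  have h1 : Complex.logTaylor (2 + 1) x = x - x ^ 2 / 2 := by
    simp [Complex.logTaylor_succ, Complex.logTaylor_zero]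
    ring
  rw [h1] at h
  refine h.trans ?_
  have h2 : (1 - ‖x‖)⁻¹ ≤ 2 := by
    rw [inv_le_comm₀ (by linarith) (by norm_num)]; linarith
  have h3 : ‖x‖ ^ 3 * (1 - ‖x‖)⁻¹ ≤ ‖x‖ ^ 3 * 2 := by gcongr
  norm_num
  have : 0 ≤ ‖x‖ ^ 3 := by positivity
  linarith

lemma norm_gammaRatioStep_le {M : ℝ} (hM : 0 ≤ M) {a : ℂ} (ha : ‖a‖ ≤ M) {z : ℝ}
    (hz : 2 * (M + 1) ≤ z) :
    ‖gammaRatioStep a z‖ ≤ (M ^ 3 + M + M * (M + 1)) / z ^ 3 := by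
  have hz0 : 0 < z := by linarith
  have hzC : (z : ℂ) ≠ 0 := by exact_mod_cast hz0.ne'
  have hzC' : (z : ℂ) + 1 ≠ 0 := by exact_mod_cast (by positivity : z + 1 ≠ 0)
  have hn : ‖(z : ℂ)‖ = z := by simp [abs_of_pos hz0]
  have hn1 : ‖(z : ℂ) + 1‖ = z + 1 := by
    rw [← Complex.ofReal_one, ← Complex.ofReal_add, Complex.norm_real, Real.norm_of_nonneg]
    linarith
  have h1 : ‖a / z‖ ≤ M / z := by rw [norm_div, hn]; gcongr
  have h1' : M / z ≤ 1 / 2 := by rw [div_le_iff₀ hz0]; linarith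
  have h2 : ‖(1 / z : ℂ)‖ = 1 / z := by rw [norm_div, hn, norm_one]
  have h2' : 1 / z ≤ 1 / 2 := by rw [div_le_iff₀ hz0]; linarith
  have e1 := norm_log_one_add_sub_le (h1.trans h1')
  have e2 := norm_log_one_add_sub_le (h2.le.trans h2')
  have hlog : ((Real.log (1 + 1 / z) : ℝ) : ℂ) = Complex.log (1 + 1 / z) := by
    rw [Complex.ofReal_log (by positivity)]; push_cast; rfl
  -- The terms of order `1/z` cancel, and those of order `1/z²` leave only a remainder of order
  -- `1/z³`; this is what the correction `a(a-1)/(2z)` is for.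
  have hdec : gammaRatioStep a z = (Complex.log (1 + a / z) - (a / z - (a / z) ^ 2 / 2))
      - a * (Complex.log (1 + 1 / z) - (1 / z - (1 / z) ^ 2 / 2))
      - a * (a - 1) / (2 * (z ^ 2 * (z + 1))) := by
    rw [gammaRatioStep, hlog]
    field_simp
    ring
  rw [hdec]
  refine (norm_sub_le _ _).trans ((add_le_add (norm_sub_le _ _) le_rfl).trans ?_)
  have e1' : ‖a / (z : ℂ)‖ ^ 3 ≤ M ^ 3 / z ^ 3 := by
    rw [← div_pow]; gcongr
  have e2' : ‖a * (Complex.log (1 + 1 / z) - (1 / z - (1 / z) ^ 2 / 2))‖ ≤ M * (1 / z ^ 3) := by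
    rw [norm_mul]
    refine mul_le_mul ha (e2.trans ?_) (norm_nonneg _) hM
    rw [h2, div_pow, one_pow]
  have e3 : ‖a * (a - 1) / (2 * ((z : ℂ) ^ 2 * (z + 1)))‖ ≤ M * (M + 1) / z ^ 3 := by
    rw [norm_div, norm_mul, norm_mul, norm_mul, norm_pow, hn, hn1]
    have : ‖a - 1‖ ≤ M + 1 := (norm_sub_le _ _).trans (by simpa using ha)
    norm_num
    gcongr
    nlinarith [pow_pos hz0 2, pow_pos hz0 3]
  calc _ ≤ M ^ 3 / z ^ 3 + M * (1 / z ^ 3) + M * (M + 1) / z ^ 3 := by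
        gcongr
        exact e1.trans e1'
    _ = _ := by ring

lemma gammaRatio_add_one {M : ℝ} {a : ℂ} (ha : ‖a‖ ≤ M) {z : ℝ} (hz : M < z) :
    gammaRatio a (z + 1) = gammaRatio a z * Complex.exp (gammaRatioStep a z) := by
  have hz0 : 0 < z := ((norm_nonneg a).trans ha).trans_lt hz
  have hzC : (z : ℂ) ≠ 0 := by exact_mod_cast hz0.ne'
  have hza : (z : ℂ) + a ≠ 0 := by
    intro h
    have : ‖a‖ = z := by
      rw [eq_neg_of_add_eq_zero_right h, norm_neg, Complex.norm_real, Real.norm_of_nonneg hz0.le]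
    linarith
  have h1 : (1 : ℂ) + a / z ≠ 0 := by
    rw [one_add_div hzC]; exact div_ne_zero hza hzC
  have hG : Complex.Gamma z ≠ 0 := Complex.Gamma_ne_zero_of_re_pos (by simpa using hz0)
  have hlog : Real.log (z + 1) = Real.log z + Real.log (1 + 1 / z) := by
    rw [← Real.log_mul hz0.ne' (by positivity)]
    congr 1
    field_simp
  have hexp : Complex.exp (-(a * Real.log (z + 1) + a * (a - 1) / (2 * ((z + 1 : ℝ) : ℂ))))
      = Complex.exp (-(a * Real.log z + a * (a - 1) / (2 * z))) *
        Complex.exp (gammaRatioStep a z) / (1 + a / z) := by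
    rw [eq_div_iff h1, ← Complex.exp_add]
    conv_lhs => arg 2; rw [← Complex.exp_log h1]
    rw [← Complex.exp_add, gammaRatioStep, hlog]
    congr 1
    push_cast
    rw [show a * (a - 1) / (2 * ((z : ℂ) + 1)) = a * (a - 1) / 2 * (1 / ((z : ℂ) + 1)) by
      rw [div_mul_div_comm, mul_one]]
    ring
  rw [gammaRatio, gammaRatio, hexp, Complex.ofReal_add, Complex.ofReal_one, add_right_comm,
    Complex.Gamma_add_one _ hza, Complex.Gamma_add_one _ hzC]
  rw [one_add_div hzC]
  field_simp

lemma Gamma_add_nat_eq_prod {s : ℂ} (hs : 0 < s.re) (n : ℕ) :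
    Complex.Gamma (s + n) = (∏ j ∈ Finset.range n, (s + j)) * Complex.Gamma s := by
  induction n with
  | zero => simp
  | succ n ih =>
    have : s + n ≠ 0 := fun h => by
      have := congrArg Complex.re h
      simp at this
      have : (0 : ℝ) ≤ n := n.cast_nonneg
      linarith
    rw [Finset.prod_range_succ, Nat.cast_add, Nat.cast_one, ← add_assoc, Complex.Gamma_add_one _ this,
      ih]
    ring

/-- A rewriting of Euler's limit formula for Gamma. -/
lemma tendsto_Gamma_add_nat_div {s : ℂ} (hs : 0 < s.re) :
    Tendsto (fun n : ℕ => Complex.Gamma (s + (n + 1 : ℕ)) / ((n : ℂ) ^ s * n.factorial)) atTop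
      (𝓝 1) := by
  have hG := Complex.Gamma_ne_zero_of_re_pos hs
  have h := (tendsto_const_nhds (x := Complex.Gamma s)).div (Complex.GammaSeq_tendsto_Gamma s) hG
  rw [div_self hG] at h
  refine h.congr fun n => ?_
  rw [Pi.div_apply, Complex.GammaSeq, Gamma_add_nat_eq_prod hs, div_div_eq_mul_div, mul_comm]

lemma tendsto_gammaRatio_add_nat {M : ℝ} {a : ℂ} (ha : ‖a‖ ≤ M) {z : ℝ} (hz : M < z) :
    Tendsto (fun n : ℕ => gammaRatio a (z + (n + 1 : ℕ))) atTop (𝓝 1) := by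
  have hz0 : 0 < z := ((norm_nonneg a).trans ha).trans_lt hz
  have hza : 0 < ((z : ℂ) + a).re := by
    have := (abs_le.1 (Complex.abs_re_le_norm a)).1
    simp
    linarith
  have h1 := (tendsto_Gamma_add_nat_div hza).div
    (tendsto_Gamma_add_nat_div (s := z) (by simpa using hz0)) one_ne_zero
  have hw : Tendsto (fun n : ℕ => z + (n + 1 : ℕ)) atTop atTop :=
    tendsto_atTop_add_const_left _ _
      (tendsto_natCast_atTop_atTop.comp (tendsto_add_atTop_nat 1))
  have h2 : Tendsto (fun n : ℕ => Real.log (z + (n + 1 : ℕ)) - Real.log n) atTop (𝓝 0) := by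
    have h3 : Tendsto (fun n : ℕ => 1 + (z + 1) / (n : ℝ)) atTop (𝓝 (1 + 0)) :=
      (tendsto_const_div_atTop_nhds_zero_nat (z + 1)).const_add 1
    have h4 := (Real.continuousAt_log (x := 1 + 0) (by norm_num)).tendsto.comp h3
    rw [add_zero, Real.log_one] at h4
    refine h4.congr' ?_
    filter_upwards [eventually_gt_atTop 0] with n hn
    have hn' : (0 : ℝ) < n := by exact_mod_cast hn
    rw [← Real.log_div (by positivity) (by positivity)]
    simp only [Function.comp_apply]
    congr 1
    push_cast
    field_simp
    ring
  have h5 : Tendsto (fun n : ℕ => (1 : ℂ) / (2 * (z + (n + 1 : ℕ) : ℝ))) atTop (𝓝 0) := by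
    have := (hw.const_mul_atTop (by norm_num : (0 : ℝ) < 2)).inv_tendsto_atTop
    have h6 := (Complex.continuous_ofReal.tendsto 0).comp this
    rw [Complex.ofReal_zero] at h6
    refine h6.congr fun n => ?_
    simp
  have h7 : Tendsto (fun n : ℕ => Complex.exp (-(a * ((Real.log (z + (n + 1 : ℕ)) - Real.log n : ℝ) : ℂ)
      + a * (a - 1) * (1 / (2 * (z + (n + 1 : ℕ) : ℝ)))))) atTop (𝓝 1) := by
    have h8 := (Complex.continuous_ofReal.tendsto 0).comp h2
    have h9 := ((h8.const_mul a).add (h5.const_mul (a * (a - 1)))).neg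
    have h10 := (Complex.continuous_exp.tendsto _).comp h9
    simpa [Function.comp_def] using h10
  have h11 := h1.mul h7
  rw [div_one, mul_one] at h11
  refine h11.congr' ?_
  filter_upwards [eventually_gt_atTop 0] with n hn
  have hn' : (n : ℂ) ≠ 0 := by exact_mod_cast hn.ne'
  have hf : (n.factorial : ℂ) ≠ 0 := by exact_mod_cast n.factorial_ne_zero
  have hnz : (n : ℂ) ^ (z : ℂ) ≠ 0 := by simp [Complex.cpow_eq_zero_iff, hn']
  have hna : (n : ℂ) ^ a ≠ 0 := by simp [Complex.cpow_eq_zero_iff, hn']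
  have hexp : Complex.exp (-(a * ((Real.log (z + (n + 1 : ℕ)) - Real.log n : ℝ) : ℂ)
      + a * (a - 1) * (1 / (2 * (z + (n + 1 : ℕ) : ℝ)))))
      = (n : ℂ) ^ a * Complex.exp (-(a * Real.log (z + (n + 1 : ℕ))
        + a * (a - 1) / (2 * (z + (n + 1 : ℕ) : ℝ)))) := by
    rw [Complex.cpow_def_of_ne_zero hn', ← Complex.exp_add, ← Complex.natCast_log]
    congr 1
    push_cast
    ring
  rw [hexp, gammaRatio, Pi.div_apply, Complex.cpow_add _ _ hn']
  rw [Complex.ofReal_add, Complex.ofReal_natCast, add_right_comm (z : ℂ) a]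
  field_simp

lemma sum_one_div_cube_le {z : ℝ} (hz : 2 ≤ z) (N : ℕ) :
    ∑ j ∈ Finset.range N, 1 / (z + j) ^ 3 ≤ 4 / z ^ 2 := by
  have h : ∀ N : ℕ, ∑ j ∈ Finset.range N, 1 / (z + j) ^ 3 ≤ 1 / (z - 1) ^ 2 - 1 / (z - 1 + N) ^ 2 := by
    intro N
    induction N with
    | zero => simp
    | succ N ih =>
      rw [Finset.sum_range_succ]
      have hw : 1 ≤ z - 1 + N := by
        have : (0 : ℝ) ≤ N := N.cast_nonneg
        linarith
      -- With `w = z - 1 + N` this is `1/(w+1)³ ≤ 1/w² - 1/(w+1)²`, so the sum telescopes.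
      have h1 : 1 / (z + N) ^ 3 ≤ 1 / (z - 1 + N) ^ 2 - 1 / (z - 1 + (N + 1 : ℕ)) ^ 2 := by
        have e1 : z + N = (z - 1 + N) + 1 := by ring
        have e2 : z - 1 + (N + 1 : ℕ) = (z - 1 + N) + 1 := by push_cast; ring
        rw [e1, e2]
        generalize z - 1 + (N : ℝ) = w at hw
        rw [div_sub_div _ _ (by positivity) (by positivity), div_le_div_iff₀ (by positivity) (by positivity)]
        have : 0 ≤ (w + 1) ^ 2 * (w ^ 2 + 3 * w + 1) := by positivity
        nlinarith [this]
      linarith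
  refine (h N).trans ?_
  have h1 : 0 ≤ 1 / (z - 1 + N) ^ 2 := by positivity
  have h2 : 1 / (z - 1) ^ 2 ≤ 4 / z ^ 2 := by
    rw [div_le_div_iff₀ (by nlinarith) (by positivity)]
    nlinarith
  linarith

lemma gammaRatio_add_nat {M : ℝ} {a : ℂ} (ha : ‖a‖ ≤ M) {z : ℝ} (hz : M < z) (N : ℕ) :
    gammaRatio a (z + N)
      = gammaRatio a z * Complex.exp (∑ j ∈ Finset.range N, gammaRatioStep a (z + j)) := by
  induction N with
  | zero => simp
  | succ N ih =>
    have : (0 : ℝ) ≤ N := N.cast_nonneg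
    rw [Finset.sum_range_succ, Complex.exp_add, ← mul_assoc, ← ih, Nat.cast_add, Nat.cast_one,
      ← add_assoc, gammaRatio_add_one ha (by linarith)]

/-- The limit `1` along `z + ℕ` is known without a rate. Going back from infinity to `z` costs a sum
of steps of size `O(z⁻³)`, which supplies the rate `z⁻²`. -/
theorem exists_norm_gammaRatio_sub_one_le {M : ℝ} (hM : 0 ≤ M) :
    ∃ C Z : ℝ, 0 < Z ∧ 0 ≤ C ∧ ∀ z, Z ≤ z → ∀ a : ℂ, ‖a‖ ≤ M → ‖gammaRatio a z - 1‖ ≤ C / z ^ 2 := by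
  set D : ℝ := M ^ 3 + M + M * (M + 1) with hD
  have hD0 : 0 ≤ D := by positivity
  -- The summand `4 * D` in the threshold forces `4 * D / z ^ 2 ≤ 1`, as needed for `‖exp u - 1‖ ≤ 2
  -- ‖u‖`, which doubles `4 * D` to `8 * D`.
  refine ⟨8 * D, 2 * (M + 1) + 4 * D, by positivity, by positivity, fun z hz a ha => ?_⟩
  have hz2 : 2 * (M + 1) ≤ z := by linarith
  have hz0 : 0 < z := by linarith
  have hS : ∀ N : ℕ, ‖∑ j ∈ Finset.range N, gammaRatioStep a (z + j)‖ ≤ 4 * D / z ^ 2 := by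
    intro N
    calc _ ≤ ∑ j ∈ Finset.range N, D * (1 / (z + j) ^ 3) := by
          refine (norm_sum_le _ _).trans (Finset.sum_le_sum fun j _ => ?_)
          have : (0 : ℝ) ≤ j := j.cast_nonneg
          rw [mul_one_div]
          exact norm_gammaRatioStep_le hM ha (by linarith)
      _ ≤ D * (4 / z ^ 2) := by
          rw [← Finset.mul_sum]
          exact mul_le_mul_of_nonneg_left (sum_one_div_cube_le (by linarith) N) hD0
      _ = _ := by ring
  have hB : 4 * D / z ^ 2 ≤ 1 := by
    rw [div_le_one (by positivity)]
    nlinarith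
  have hbound : ∀ N : ℕ, ‖gammaRatio a z - 1‖
      ≤ ‖gammaRatio a (z + N) - 1‖ * Real.exp 1 + 8 * D / z ^ 2 := by
    intro N
    set S := ∑ j ∈ Finset.range N, gammaRatioStep a (z + j) with hSdef
    have h1 : gammaRatio a z - 1
        = (gammaRatio a (z + N) - 1) * Complex.exp (-S) + (Complex.exp (-S) - 1) := by
      rw [gammaRatio_add_nat ha (by linarith) N, ← hSdef, Complex.exp_neg]
      field_simp [Complex.exp_ne_zero]
      ring
    have hSn : ‖-S‖ ≤ 4 * D / z ^ 2 := by rw [norm_neg]; exact hS N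
    rw [h1]
    refine (norm_add_le _ _).trans (add_le_add ?_ ?_)
    · rw [norm_mul]
      gcongr
      exact (Complex.norm_exp_le_exp_norm _).trans (Real.exp_le_exp.2 (hSn.trans hB))
    · refine (Complex.norm_exp_sub_one_le (hSn.trans hB)).trans ?_
      calc _ ≤ 2 * (4 * D / z ^ 2) := by gcongr
        _ = _ := by ring
  have hlim : Tendsto (fun n : ℕ => ‖gammaRatio a (z + (n + 1 : ℕ)) - 1‖ * Real.exp 1
      + 8 * D / z ^ 2) atTop (𝓝 (‖(1 : ℂ) - 1‖ * Real.exp 1 + 8 * D / z ^ 2)) :=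
    ((((tendsto_gammaRatio_add_nat ha (by linarith)).sub_const 1).norm).mul_const _).add_const _
  rw [sub_self, norm_zero, zero_mul, zero_add] at hlim
  exact ge_of_tendsto' hlim fun n => hbound (n + 1)

end GammaRatio

/-! ### Normalised factors and their product. -/

section Product

open Topology

lemma abs_log_sub_log_sub_le {K : ℝ} (hK : 2 ≤ K) :
    |Real.log K - Real.log (K - 1) - (1 / K + 1 / (2 * K ^ 2))| ≤ 2 / K ^ 3 := by
  have hK0 : 0 < K := by linarith
  have hx : 1 / K ≤ 1 / 2 := by gcongr
  have hx0 : 0 < 1 / K := by positivity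
  have h := Real.abs_log_sub_add_sum_range_le (x := 1 / K)
    (by rw [abs_of_pos hx0]; linarith) 2
  have hlog : Real.log (1 - 1 / K) = Real.log (K - 1) - Real.log K := by
    rw [← Real.log_div (by linarith) (by linarith)]
    congr 1
    field_simp
  rw [hlog, abs_of_pos hx0] at h
  simp only [Finset.sum_range_succ, Finset.sum_range_zero] at h
  have h1 : (1 / K) ^ (2 + 1) / (1 - 1 / K) ≤ 2 / K ^ 3 := by
    rw [div_le_iff₀ (by linarith), div_pow, one_pow]
    have : 1 / K ^ 3 = 2 / K ^ 3 * (1 / 2) := by ring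
    rw [show 2 + 1 = 3 from rfl, this]
    gcongr
    linarith
  refine le_trans (le_of_eq ?_) (h.trans h1)
  rw [← abs_neg]
  congr 1
  norm_num
  field_simp
  ring

lemma abs_log_sub_log_sub_inv_le {K : ℝ} (hK : 2 ≤ K) :
    |Real.log K - Real.log (K - 1) - 1 / K| ≤ 2 / K ^ 2 := by
  have hK0 : 0 < K := by linarith
  have h := abs_le.1 (abs_log_sub_log_sub_le hK)
  have h1 : 2 / K ^ 3 ≤ 1 / K ^ 2 := by
    rw [div_le_div_iff₀ (by positivity) (by positivity)]
    nlinarith [pow_pos hK0 2]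
  have h2 : 1 / (2 * K ^ 2) = 1 / 2 * (1 / K ^ 2) := by field_simp
  have h3 : 2 / K ^ 2 = 2 * (1 / K ^ 2) := by ring
  have h4 : 0 < 1 / K ^ 2 := by positivity
  rw [abs_le]
  constructor <;> linarith

/-- The shift by `1/2` cancels the term of order `1/K`: `(K - 1/2)(1/K + 1/(2K²)) = 1 - 1/(4K²)`. It
comes from the summand `(log n)/2` in `centering`. -/
lemma abs_centering_step_sub_le {K : ℝ} (hK : 2 ≤ K) :
    |(K - 1 / 2) * (Real.log K - Real.log (K - 1)) - 1| ≤ 3 / K ^ 2 := by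
  have hK0 : 0 < K := by linarith
  have h := abs_log_sub_log_sub_le hK
  set e := Real.log K - Real.log (K - 1) - (1 / K + 1 / (2 * K ^ 2)) with he
  have h1 : (K - 1 / 2) * (Real.log K - Real.log (K - 1)) - 1
      = (K - 1 / 2) * e - 1 / 4 * (1 / K ^ 2) := by
    rw [he]
    field_simp
    ring
  have h2 : |(K - 1 / 2) * e| ≤ 2 / K ^ 2 := by
    rw [abs_mul, abs_of_pos (by linarith)]
    calc _ ≤ K * (2 / K ^ 3) := by gcongr; linarith
      _ = _ := by field_simp
  have h3 : 0 < 1 / K ^ 2 := by positivity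
  rw [h1]
  refine (abs_sub _ _).trans ?_
  rw [abs_of_pos (by positivity : 0 < 1 / 4 * (1 / K ^ 2))]
  calc _ ≤ 2 / K ^ 2 + 1 / 4 * (1 / K ^ 2) := by gcongr
    _ ≤ 2 / K ^ 2 + 1 * (1 / K ^ 2) := by gcongr; norm_num
    _ = _ := by ring

/-- The normalised contribution of the dimension `k + 1` to the moment generating function of the
centred log-volume. -/
noncomputable def volumeFactor (k : ℕ) (t : ℂ) : ℂ :=
  chiMGF (k + 1) t * Complex.exp (-(t * (centering (k + 1) - centering k : ℝ))
    + (t / 2 - t ^ 2 / 4) * (Real.log (k + 1) - Real.log k : ℝ))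

lemma centering_succ_sub (k : ℕ) :
    centering (k + 1) - centering k - 1 / 2 * Real.log (k + 1)
      = 1 / 2 * (((k + 1 : ℝ) - 1 / 2) * (Real.log (k + 1) - Real.log k) - 1) := by
  rw [centering, centering]
  push_cast
  ring

/-- Here `a = t/2` and `z = (k+1)/2`; both real brackets left in the exponent are `O(k⁻²)`. -/
lemma volumeFactor_eq (k : ℕ) (t : ℂ) :
    volumeFactor k t = gammaRatio (t / 2) ((k + 1) / 2) * Complex.exp
      (-t * (1 / 2 * (((k + 1 : ℝ) - 1 / 2) * (Real.log (k + 1) - Real.log k) - 1) : ℝ)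
        + (t / 2 - t ^ 2 / 4) * (Real.log (k + 1) - Real.log k - 1 / (k + 1) : ℝ)) := by
  have hk : (0 : ℝ) < k + 1 := by positivity
  have hkC : (k : ℂ) + 1 ≠ 0 := by exact_mod_cast hk.ne'
  rw [← centering_succ_sub, volumeFactor, chiMGF, gammaRatio, Real.log_div hk.ne' two_ne_zero,
    Complex.cpow_def_of_ne_zero two_ne_zero, show (2 : ℂ) = ((2 : ℝ) : ℂ) by norm_num,
    ← Complex.ofReal_log (by norm_num)]
  generalize Real.log (k : ℝ) = l
  generalize Real.log ((k : ℝ) + 1) = l'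
  generalize Real.log (2 : ℝ) = s
  push_cast
  have hsplit : Complex.exp (s * (t / 2)) *
      Complex.exp (-(t * (centering (k + 1) - centering k : ℂ))
        + (t / 2 - t ^ 2 / 4) * (l' - l))
      = Complex.exp (-(t / 2 * (l' - s) + t / 2 * (t / 2 - 1) / (2 * ((k + 1) / 2)))) *
        Complex.exp (-t * (centering (k + 1) - centering k - 1 / 2 * l')
        + (t / 2 - t ^ 2 / 4) * (l' - l - 1 / (k + 1))) := by
    rw [← Complex.exp_add, ← Complex.exp_add]
    congr 1
    field_simp
    ring
  rw [add_div, mul_assoc (_ / _), ← hsplit]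
  ring

theorem exists_norm_volumeFactor_sub_one_le {M : ℝ} (hM : 0 ≤ M) :
    ∃ (C : ℝ) (k₀ : ℕ), 0 ≤ C ∧ ∀ k, k₀ ≤ k → ∀ t : ℂ, ‖t‖ ≤ M →
      ‖volumeFactor k t - 1‖ ≤ C / (k + 1) ^ 2 := by
  obtain ⟨C, Z, hZ, hC, h⟩ := exists_norm_gammaRatio_sub_one_le hM
  set D : ℝ := 3 * M + 2 * (M + M ^ 2) with hD
  have hD0 : 0 ≤ D := by positivity
  refine ⟨4 * C * Real.exp 1 + 2 * D, ⌈2 * Z + D⌉₊ + 1, by positivity, fun k hk t ht => ?_⟩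
  have hk1 : 2 * Z + D + 1 ≤ k := by
    have : ((⌈2 * Z + D⌉₊ + 1 : ℕ) : ℝ) ≤ k := by exact_mod_cast hk
    push_cast at this
    linarith [Nat.le_ceil (2 * Z + D)]
  set K : ℝ := (k : ℝ) + 1 with hK
  have hK2 : 2 ≤ K := by linarith
  have hkK : (k : ℝ) = K - 1 := by rw [hK]; ring
  have hg := h (K / 2) (by linarith) (t / 2) (by
    rw [norm_div, Complex.norm_ofNat]; linarith [norm_nonneg t])
  rw [volumeFactor_eq, hkK, sub_add_cancel]
  set A : ℝ := 1 / 2 * ((K - 1 / 2) * (Real.log K - Real.log (K - 1)) - 1) with hA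
  set B : ℝ := Real.log K - Real.log (K - 1) - 1 / K with hB
  have hA1 : |A| ≤ 3 / K ^ 2 := by
    rw [hA, abs_mul, abs_of_pos (by norm_num : (0 : ℝ) < 1 / 2)]
    linarith [abs_centering_step_sub_le hK2, abs_nonneg ((K - 1 / 2) * (Real.log K - Real.log (K - 1)) - 1)]
  have hB1 : |B| ≤ 2 / K ^ 2 := abs_log_sub_log_sub_inv_le hK2
  set e : ℂ := -t * A + (t / 2 - t ^ 2 / 4) * B with he
  have hen : ‖e‖ ≤ D / K ^ 2 := by
    have h1 : ‖t / 2 - t ^ 2 / 4‖ ≤ M + M ^ 2 := by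
      refine (norm_sub_le _ _).trans ?_
      rw [norm_div, norm_div, norm_pow, Complex.norm_ofNat, Complex.norm_ofNat]
      have : ‖t‖ ^ 2 ≤ M ^ 2 := by gcongr
      have := sq_nonneg ‖t‖
      linarith [norm_nonneg t]
    calc ‖e‖ ≤ ‖t‖ * |A| + ‖t / 2 - t ^ 2 / 4‖ * |B| := by
          refine (norm_add_le _ _).trans (le_of_eq ?_)
          rw [norm_mul, norm_mul, norm_neg, Complex.norm_real, Complex.norm_real,
            Real.norm_eq_abs, Real.norm_eq_abs]
      _ ≤ M * (3 / K ^ 2) + (M + M ^ 2) * (2 / K ^ 2) := by gcongr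
      _ = D / K ^ 2 := by rw [hD]; ring
  have hD1 : D / K ^ 2 ≤ 1 := by
    rw [div_le_one (by positivity)]
    nlinarith
  set q := gammaRatio (t / 2) (K / 2) with hq
  have hdec : q * Complex.exp e - 1 = (q - 1) * Complex.exp e + (Complex.exp e - 1) := by ring
  rw [hdec]
  calc _ ≤ ‖q - 1‖ * ‖Complex.exp e‖ + ‖Complex.exp e - 1‖ := by
        rw [← norm_mul]; exact norm_add_le _ _
    _ ≤ C / (K / 2) ^ 2 * Real.exp 1 + 2 * (D / K ^ 2) := by
        gcongr
        · exact (Complex.norm_exp_le_exp_norm _).trans (Real.exp_le_exp.2 (hen.trans hD1))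
        · exact (Complex.norm_exp_sub_one_le (hen.trans hD1)).trans (by gcongr)
    _ = _ := by field_simp; ring

lemma sum_one_div_sq_le {p : ℕ} (hp : 1 ≤ p) (r : ℕ) :
    ∑ i ∈ Finset.range r, 1 / (((p + i : ℕ) : ℝ) + 1) ^ 2 ≤ 1 / (p : ℝ) := by
  have hp0 : (0 : ℝ) < p := by exact_mod_cast hp
  have h : ∑ i ∈ Finset.range r, 1 / (((p + i : ℕ) : ℝ) + 1) ^ 2 ≤ 1 / (p : ℝ) - 1 / ((p : ℝ) + r) := by
    induction r with
    | zero => simp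
    | succ r ih =>
      rw [Finset.sum_range_succ]
      have h1 : 1 / (((p + r : ℕ) : ℝ) + 1) ^ 2 ≤ 1 / ((p : ℝ) + r) - 1 / ((p : ℝ) + (r + 1 : ℕ)) := by
        push_cast
        rw [← add_assoc]
        have hw : (0 : ℝ) < p + r := by positivity
        generalize (p : ℝ) + r = w at hw
        rw [div_sub_div _ _ (by positivity) (by positivity),
          div_le_div_iff₀ (by positivity) (by positivity)]
        nlinarith
      linarith
  have : (0 : ℝ) ≤ 1 / ((p : ℝ) + r) := by positivity
  linarith

/-- The bound is uniform in the number `r` of factors, because the errors sum to at most `C / p`. -/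
theorem norm_prod_volumeFactor_sub_one_le {M : ℝ} (hM : 0 ≤ M) {ε : ℝ} (hε : 0 < ε) :
    ∃ p₀ : ℕ, 1 ≤ p₀ ∧ ∀ p, p₀ ≤ p → ∀ (r : ℕ) (t : ℂ), ‖t‖ ≤ M →
      ‖∏ i ∈ Finset.range r, volumeFactor (p + i) t - 1‖ < ε := by
  obtain ⟨C, k₀, hC, h⟩ := exists_norm_volumeFactor_sub_one_le hM
  have hlim : Tendsto (fun p : ℕ => Real.exp (C / p) - 1) atTop (𝓝 0) := by
    have := (Real.continuous_exp.tendsto 0).comp (tendsto_const_div_atTop_nhds_zero_nat C)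
    simpa [Function.comp_def] using this.sub_const 1
  obtain ⟨p₁, hp₁⟩ := eventually_atTop.1 (hlim.eventually (gt_mem_nhds hε))
  refine ⟨max (max 1 k₀) p₁, by simp, fun p hp r t ht => ?_⟩
  have hp1 : 1 ≤ p := by omega
  have hk : k₀ ≤ p := by omega
  calc _ = ‖∏ i ∈ Finset.range r, (1 + (volumeFactor (p + i) t - 1)) - 1‖ := by
        simp
    _ ≤ Real.exp (∑ i ∈ Finset.range r, ‖volumeFactor (p + i) t - 1‖) - 1 :=
        Finset.norm_prod_one_add_sub_one_le _ _
    _ ≤ Real.exp (C / p) - 1 := by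
        gcongr
        calc _ ≤ ∑ i ∈ Finset.range r, C * (1 / (((p + i : ℕ) : ℝ) + 1) ^ 2) := by
              refine Finset.sum_le_sum fun i _ => ?_
              rw [mul_one_div]
              exact h _ (by omega) t ht
          _ ≤ C * (1 / p) := by
              rw [← Finset.mul_sum]
              exact mul_le_mul_of_nonneg_left (sum_one_div_sq_le hp1 r) hC
          _ = _ := by ring
    _ < ε := hp₁ p (by omega)

lemma prod_volumeFactor (p r : ℕ) (t : ℂ) :
    ∏ i ∈ Finset.range r, volumeFactor (p + i) t
      = (∏ i ∈ Finset.range r, chiMGF (p + i + 1) t) *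
        Complex.exp (-(t * (centering (p + r) - centering p : ℝ))
          + (t / 2 - t ^ 2 / 4) * (Real.log (p + r : ℕ) - Real.log p : ℝ)) := by
  induction r with
  | zero => simp
  | succ r ih =>
    rw [Finset.prod_range_succ, Finset.prod_range_succ, ih, volumeFactor, mul_mul_mul_comm,
      ← Complex.exp_add]
    congr 2
    push_cast
    rw [add_assoc (p : ℝ) r 1, add_assoc p r 1]
    ring

end Product

/-! ### Moment generating function of the log-volume. -/

section VolumeMoments

variable {Ω : Type*} [MeasurableSpace Ω] {P : Measure Ω} {n r : ℕ}

lemma logVolume_eq (hr : 1 ≤ r) (x : Fin (r + 1) → EuclideanSpace ℝ (Fin n)) :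
    logVolume x = Real.log √(Matrix.gram ℝ fun i : Fin r => x i.succ - x 0).det := by
  rw [logVolume, factorial_mul_simplexVolume hr]

lemma measurable_logVolume (hr : 1 ≤ r) :
    Measurable (logVolume : (Fin (r + 1) → EuclideanSpace ℝ (Fin n)) → ℝ) := by
  have h : (logVolume : (Fin (r + 1) → EuclideanSpace ℝ (Fin n)) → ℝ)
      = fun x => Real.log √(Matrix.gram ℝ fun i : Fin r => x i.succ - x 0).det :=
    funext (logVolume_eq hr)
  have h1 : Measurable fun x : Fin (r + 1) → EuclideanSpace ℝ (Fin n) =>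
      (Matrix.gram ℝ fun i : Fin r => x i.succ - x 0).det :=
    measurable_det_gram.comp (by fun_prop)
  rw [h]
  fun_prop

lemma IsGaussianSample.hasLaw_fun {X : Fin (r + 1) → Ω → EuclideanSpace ℝ (Fin n)}
    (hX : IsGaussianSample P X) :
    HasLaw (fun ω i => X i ω) (Measure.pi fun _ => stdGaussian (EuclideanSpace ℝ (Fin n))) P :=
  hX.indep.hasLaw_pi hX.hasLaw

lemma map_rotate_succ {E : Type*} [NormedAddCommGroup E] [InnerProductSpace ℝ E]
    [FiniteDimensional ℝ E] [MeasurableSpace E] [BorelSpace E]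
    (b : OrthonormalBasis (Fin (r + 1)) ℝ (EuclideanSpace ℝ (Fin (r + 1)))) :
    MeasurePreserving (fun (x : Fin (r + 1) → E) (i : Fin r) => rotate b x i.succ)
      (Measure.pi fun _ => stdGaussian E) (Measure.pi fun _ => stdGaussian E) := by
  have h1 : MeasurePreserving (rotate b : (Fin (r + 1) → E) → _)
      (Measure.pi fun _ => stdGaussian E) (Measure.pi fun _ => stdGaussian E) :=
    ⟨by unfold rotate; fun_prop, map_rotate_pi_stdGaussian b⟩
  exact (measurePreserving_fst.comp (measurePreserving_tail_head (E := E) r)).comp h1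

lemma logVolume_moment [IsProbabilityMeasure P] (hr : 1 ≤ r) (hrn : r ≤ n)
    {X : Fin (r + 1) → Ω → EuclideanSpace ℝ (Fin n)} (hX : IsGaussianSample P X) {t : ℂ}
    (ht : -((n : ℝ) - r + 1) < t.re) :
    Integrable (fun ω => Complex.exp (t * logVolume fun i => X i ω)) P ∧
    ∫ ω, Complex.exp (t * logVolume fun i => X i ω) ∂P
      = Complex.exp (t * (1 / 2 * Real.log (r + 1) : ℝ))
        * ∏ j ∈ Finset.range r, chiMGF (n - j) t := by
  obtain ⟨b, hb⟩ := exists_orthonormalBasis_const r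
  have hlaw := hX.hasLaw_fun
  have hmp := map_rotate_succ (E := EuclideanSpace ℝ (Fin n)) b
  set γ := Measure.pi fun _ : Fin (r + 1) => stdGaussian (EuclideanSpace ℝ (Fin n)) with hγ
  have hdim : Module.finrank ℝ (EuclideanSpace ℝ (Fin n)) = n := finrank_euclideanSpace_fin
  obtain ⟨h1, h2⟩ := integral_exp_log_det_gram (E := EuclideanSpace ℝ (Fin n)) (r := r)
    (by rw [hdim]; exact hrn) (t := t) (by rw [hdim]; exact ht)
  have h3 := ae_det_gram_ne_zero (E := EuclideanSpace ℝ (Fin n)) (r := r) (by rw [hdim]; exact hrn)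
  have hm : Measurable fun z : Fin r → EuclideanSpace ℝ (Fin n) =>
      Complex.exp (t * Real.log √(Matrix.gram ℝ z).det) := by fun_prop
  have hmV := measurable_logVolume (n := n) hr
  have hmX : AEStronglyMeasurable (fun x : Fin (r + 1) → EuclideanSpace ℝ (Fin n) =>
      Complex.exp (t * logVolume x)) γ :=
    Measurable.aestronglyMeasurable (by fun_prop)
  have h4 : (fun x : Fin (r + 1) → EuclideanSpace ℝ (Fin n) =>
      Complex.exp (t * (1 / 2 * Real.log (r + 1) : ℝ)) *
        Complex.exp (t * Real.log √(Matrix.gram ℝ fun i : Fin r => rotate b x i.succ).det))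
      =ᵐ[γ] fun x => Complex.exp (t * logVolume x) := by
    filter_upwards [hmp.quasiMeasurePreserving.ae h3] with x hx
    have hd : 0 < (Matrix.gram ℝ fun i : Fin r => rotate b x i.succ).det :=
      (det_gram_nonneg _).lt_of_ne' hx
    rw [logVolume_eq hr, det_gram_sub_eq b hb, Real.sqrt_mul (by positivity),
      Real.log_mul (by positivity) (by positivity), Real.log_sqrt (by positivity : (0 : ℝ) ≤ r + 1),
      ← Complex.exp_add, Complex.ofReal_add, mul_add, one_div_mul_eq_div]
  have h5 := (hmp.integrable_comp hm.aestronglyMeasurable).2 h1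
  have h6 : Integrable (fun x : Fin (r + 1) → EuclideanSpace ℝ (Fin n) =>
      Complex.exp (t * logVolume x)) γ := (h5.const_mul _).congr h4
  have h7 : ∫ x, Complex.exp (t * logVolume x) ∂γ
      = Complex.exp (t * (1 / 2 * Real.log (r + 1) : ℝ))
        * ∏ j ∈ Finset.range r, chiMGF (n - j) t := by
    rw [hdim] at h2
    rw [← integral_congr_ae h4, integral_const_mul, ← h2, ← hmp.map_eq,
      integral_map hmp.measurable.aemeasurable hm.aestronglyMeasurable]
  rw [← hlaw.map_eq] at h6 h7 hmX
  exact ⟨(integrable_map_measure hmX hlaw.aemeasurable).1 h6,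
    by rw [← h7, integral_map hlaw.aemeasurable hmX]⟩

/-- The deterministic part of `centredLogVolume`. -/
noncomputable def logVolumeCentre (n r : ℕ) : ℝ :=
  centering n - centering (n - r) + (1 / 2) * Real.log (((r : ℝ) + 1) * ((n : ℝ) - r) / n)

lemma exp_mul_centredLogVolume (t : ℂ) (x : Fin (r + 1) → EuclideanSpace ℝ (Fin n)) :
    Complex.exp (t * centredLogVolume x)
      = Complex.exp (-(t * logVolumeCentre n r)) * Complex.exp (t * logVolume x) := by
  rw [← Complex.exp_add, centredLogVolume, logVolumeCentre]
  congr 1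
  push_cast
  ring

lemma integrable_exp_centredLogVolume [IsProbabilityMeasure P] (hr : 1 ≤ r) (hrn : r ≤ n)
    {X : Fin (r + 1) → Ω → EuclideanSpace ℝ (Fin n)} (hX : IsGaussianSample P X) {t : ℂ}
    (ht : -((n : ℝ) - r + 1) < t.re) :
    Integrable (fun ω => Complex.exp (t * centredLogVolume fun i => X i ω)) P := by
  simp_rw [exp_mul_centredLogVolume]
  exact (logVolume_moment hr hrn hX ht).1.const_mul _

lemma aemeasurable_centredLogVolume (hr : 1 ≤ r)
    {X : Fin (r + 1) → Ω → EuclideanSpace ℝ (Fin n)} (hX : IsGaussianSample P X) :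
    AEMeasurable (fun ω => centredLogVolume fun i => X i ω) P :=
  ((((measurable_logVolume hr).comp_aemeasurable hX.hasLaw_fun.aemeasurable).sub_const _).sub_const
    _)

/-- The `(r+1)^(t/2)` from the rotation cancels against the centring, and `(n-r)/n` there supplies
the `t/2` part of the logarithmic exponent of `volumeFactor`. Strictness `r < n` keeps all
logarithms genuine. -/
lemma complexMGF_centredLogVolume_div [IsProbabilityMeasure P] (hr : 1 ≤ r) (hrn : r < n)
    {X : Fin (r + 1) → Ω → EuclideanSpace ℝ (Fin n)} (hX : IsGaussianSample P X) {t : ℂ}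
    (ht : -((n : ℝ) - r + 1) < t.re) :
    complexMGF (fun ω => centredLogVolume fun i => X i ω) P t /
      Complex.exp ((1 / 4) * t ^ 2 * (Real.log ((n : ℝ) / ((n : ℝ) - r)) : ℂ))
      = ∏ i ∈ Finset.range r, volumeFactor (n - r + i) t := by
  obtain ⟨p, rfl⟩ : ∃ p, n = p + r := ⟨n - r, by omega⟩
  have hp : (0 : ℝ) < p := by
    have : 0 < p := by omega
    exact_mod_cast this
  have hprod : ∏ j ∈ Finset.range r, chiMGF (p + r - j) t
      = ∏ i ∈ Finset.range r, chiMGF (p + i + 1) t := by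
    rw [← Finset.prod_range_reflect]
    refine Finset.prod_congr rfl fun i hi => ?_
    rw [Finset.mem_range] at hi
    congr 1
    omega
  rw [complexMGF]
  simp_rw [exp_mul_centredLogVolume]
  rw [integral_const_mul, (logVolume_moment hr hrn.le hX ht).2, hprod, Nat.add_sub_cancel,
    prod_volumeFactor, logVolumeCentre, Nat.add_sub_cancel, div_eq_iff (Complex.exp_ne_zero _),
    mul_assoc (∏ i ∈ _, _), ← Complex.exp_add, ← mul_assoc, ← Complex.exp_add, mul_comm]
  congr 2
  have hpr : ((p + r : ℕ) : ℝ) - r = p := by push_cast; ring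
  have hpr0 : ((p + r : ℕ) : ℝ) ≠ 0 := by positivity
  rw [hpr, Real.log_div hpr0 hp.ne', Real.log_div (by positivity) hpr0,
    Real.log_mul (by positivity) hp.ne']
  generalize Real.log ((p + r : ℕ) : ℝ) = l
  generalize Real.log (p : ℝ) = l'
  generalize Real.log ((r : ℝ) + 1) = l''
  push_cast
  ring

end VolumeMoments

/-! ### The reference Gaussian law. -/

section Gaussian

open scoped NNReal

lemma isInfinitelyDivisible_gaussianReal : IsInfinitelyDivisible (gaussianReal 0 1) := by
  refine ⟨inferInstance, fun k hk => ⟨gaussianReal 0 (1 / k), inferInstance, ?_⟩⟩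
  have hk0 : (k : ℂ) ≠ 0 := by exact_mod_cast (by omega : k ≠ 0)
  have : IsProbabilityMeasure ((Measure.pi fun _ : Fin k => gaussianReal 0 (1 / k)).map
      fun x => ∑ i, x i) := Measure.isProbabilityMeasure_map (by fun_prop)
  refine Measure.ext_of_charFun ?_
  ext t
  rw [charFun_map_sum_pi_eq_prod]
  simp only [Finset.prod_apply, charFun_gaussianReal, Finset.prod_const, Finset.card_univ,
    Fintype.card_fin, ← Complex.exp_nat_mul]
  congr 1
  push_cast
  field_simp
  ring

lemma integrable_cexp_gaussianReal (z : ℂ) :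
    Integrable (fun x : ℝ => Complex.exp (z * x)) (gaussianReal 0 1) := by
  have h := integrable_exp_mul_gaussianReal (μ := 0) (v := 1) z.re
  refine (integrable_norm_iff (by fun_prop)).1 (h.congr (ae_of_all _ fun x => ?_))
  simp [Complex.norm_exp]

lemma integral_cexp_gaussianReal (z : ℂ) :
    ∫ x : ℝ, Complex.exp (z * x) ∂gaussianReal 0 1 = Complex.exp (z ^ 2 / 2) := by
  have h := complexMGF_gaussianReal (p := gaussianReal 0 1) (X := id) Measure.map_id z
  simpa [complexMGF] using h

end Gaussian

/-! ### Passage to the limit. -/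

lemma tendstoLocallyUniformly_complexMGF_centredLogVolume {Ω : ℕ → Type*}
    [∀ n, MeasurableSpace (Ω n)] (P : ∀ n, Measure (Ω n)) [∀ n, IsProbabilityMeasure (P n)]
    (r : ℕ → ℕ) (hr : ∀ n : ℕ, 1 ≤ n → 1 ≤ r n ∧ r n ≤ n)
    (X : ∀ n, Fin (r n + 1) → Ω n → EuclideanSpace ℝ (Fin n))
    (hX : ∀ n : ℕ, 1 ≤ n → IsGaussianSample (P n) (X n))
    (hcodim : Tendsto (fun n : ℕ => (n : ℝ) - r n) atTop atTop) :
    TendstoLocallyUniformly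
      (fun (n : ℕ) (t : ℂ) =>
        complexMGF (fun ω => centredLogVolume (fun i => X n i ω)) (P n) t /
          Complex.exp ((1 / 4) * t ^ 2 * (Real.log ((n : ℝ) / ((n : ℝ) - r n)) : ℂ)))
      (fun _ => 1) atTop := by
  rw [Metric.tendstoLocallyUniformly_iff]
  intro ε hε t₀
  set M : ℝ := ‖t₀‖ + 1 with hM
  obtain ⟨p₀, hp₀, h⟩ := norm_prod_volumeFactor_sub_one_le (M := M) (by positivity) hε
  refine ⟨Metric.ball 0 M, Metric.isOpen_ball.mem_nhds (by simp [hM]), ?_⟩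
  -- `n - r ≥ M` places the whole ball of radius `M` in the half-plane of existence; `n - r ≥ p₀ ≥
  -- 1` gives the product estimate and excludes `r = n`.
  filter_upwards [hcodim.eventually_ge_atTop (max p₀ M), eventually_ge_atTop 1] with n hn hn1 t ht
  obtain ⟨hr1, hrn⟩ := hr n hn1
  have hp : p₀ ≤ n - r n := by
    have : (p₀ : ℝ) ≤ ((n - r n : ℕ) : ℝ) := by
      rw [Nat.cast_sub hrn]; exact (le_max_left _ _).trans hn
    exact_mod_cast this
  have htM : ‖t‖ < M := by simpa using ht
  have hre : -((n : ℝ) - r n + 1) < t.re := by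
    have := (abs_le.1 (Complex.abs_re_le_norm t)).1
    have := (le_max_right _ _).trans hn
    linarith
  rw [complexMGF_centredLogVolume_div hr1 (by omega) (hX n hn1) hre, dist_comm, dist_eq_norm]
  exact h _ hp _ _ htM.le

lemma tendsto_log_div_atTop (r : ℕ → ℕ)
    (hcodim : Tendsto (fun n : ℕ => (n : ℝ) - r n) atTop atTop)
    (ho : (fun n : ℕ => (n : ℝ) - r n) =o[atTop] (fun n : ℕ => (n : ℝ))) :
    Tendsto (fun n : ℕ => (1 / 2) * Real.log ((n : ℝ) / ((n : ℝ) - r n))) atTop atTop := by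
  refine Tendsto.const_mul_atTop (by norm_num) (Real.tendsto_log_atTop.comp ?_)
  have h1 : Tendsto (fun n : ℕ => ((n : ℝ) - r n) / n) atTop (nhdsWithin 0 (Set.Ioi 0)) := by
    refine tendsto_nhdsWithin_iff.2 ⟨ho.tendsto_div_nhds_zero, ?_⟩
    filter_upwards [hcodim.eventually_gt_atTop 0, eventually_gt_atTop 0] with n hn hn0
    have : (0 : ℝ) < n := by exact_mod_cast hn0
    exact div_pos hn this
  refine h1.inv_tendsto_nhdsGT_zero.congr fun n => ?_
  simp

end RandomSimplex

theorem mainTheorem11 {Ω : ℕ → Type*} [∀ n, MeasurableSpace (Ω n)]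
    (P : ∀ n, Measure (Ω n)) [∀ n, IsProbabilityMeasure (P n)]
    (r : ℕ → ℕ) (hr : ∀ n : ℕ, 1 ≤ n → 1 ≤ r n ∧ r n ≤ n)
    (X : ∀ n, Fin (r n + 1) → Ω n → EuclideanSpace ℝ (Fin n))
    (hX : ∀ n : ℕ, 1 ≤ n → RandomSimplex.IsGaussianSample (P n) (X n))
    (hcodim : Tendsto (fun n : ℕ => (n : ℝ) - r n) atTop atTop) :
    ((∀ n : ℕ, 1 ≤ n → ∀ t : ℂ, -((n : ℝ) - r n + 1) < t.re →
        Integrable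
          (fun ω => Complex.exp (t * RandomSimplex.centredLogVolume (fun i => X n i ω))) (P n)) ∧
      TendstoLocallyUniformly
        (fun (n : ℕ) (t : ℂ) =>
          complexMGF (fun ω => RandomSimplex.centredLogVolume (fun i => X n i ω)) (P n) t /
            Complex.exp ((1 / 4) * t ^ 2 * (Real.log ((n : ℝ) / ((n : ℝ) - r n)) : ℂ)))
        (fun _ => 1) atTop) ∧
    ((fun n : ℕ => (n : ℝ) - r n) =o[atTop] (fun n : ℕ => (n : ℝ)) →
      RandomSimplex.ModGaussianConverges P
        (fun n ω => RandomSimplex.centredLogVolume (fun i => X n i ω))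
        (fun n : ℕ => (1 / 2) * Real.log ((n : ℝ) / ((n : ℝ) - r n)))
        (fun _ => 1) (-1) ⊤) := by
  have hint : ∀ n : ℕ, 1 ≤ n → ∀ t : ℂ, -((n : ℝ) - r n + 1) < t.re → Integrable
      (fun ω => Complex.exp (t * RandomSimplex.centredLogVolume (fun i => X n i ω))) (P n) :=
    fun n hn t ht =>
      RandomSimplex.integrable_exp_centredLogVolume (hr n hn).1 (hr n hn).2 (hX n hn) ht
  have hlim := RandomSimplex.tendstoLocallyUniformly_complexMGF_centredLogVolume P r hr X hX hcodim
  refine ⟨⟨hint, hlim⟩, fun ho => ?_⟩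
  exact
    { lt := EReal.coe_lt_top (-1)
      infinitelyDivisible := RandomSimplex.isInfinitelyDivisible_gaussianReal
      integrable_exp := fun z _ => RandomSimplex.integrable_cexp_gaussianReal z
      mgf_eq := fun z _ => RandomSimplex.integral_cexp_gaussianReal z
      aemeasurable := fun n hn =>
        RandomSimplex.aemeasurable_centredLogVolume (hr n hn).1 (hX n hn)
      -- Since `n - r ≥ 0`, the strip `Re z > -1` lies in every half-plane `Re z > -(n - r + 1)`,
      -- including when `r = n`.
      integrable := fun n hn z hz => hint n hn z (by
        have h1 : (-1 : ℝ) < z.re := EReal.coe_lt_coe_iff.1 (by simpa using hz.1)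
        have h2 : (r n : ℝ) ≤ n := by exact_mod_cast (hr n hn).2
        linarith)
      tendsto_param := RandomSimplex.tendsto_log_div_atTop r hcodim ho
      analytic := analyticOnNhd_const
      tendsto := by
        refine (hlim.tendstoLocallyUniformlyOn (s := RandomSimplex.strip (-1) ⊤)).congr
          fun n z _ => ?_
        simp only
        congr 2
        push_cast
        ring }
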